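/- Let $\mathbb H_2$ be the upper half-plane with its hyperbolic metric, and let $G$ be the group of transformations $z\mapsto az+b$ of $\mathbb H_2$ with $a>0$, $b\in\mathbb R$, equipped with the left-invariant metric $d(g,h)=d_{\mathbb H_2}(g\cdot i,h\cdot i)$. Put $R:z\mapsto 2z$ and $S:z\mapsto z+1$. Let $P$ be the convex hyperbolic pentagon with vertices $i,\ \tfrac12+i,\ 1+i,\ 1+2i,\ 2i$, and let $\mathcal P=\{R^kS^nP : k,n\in\mathbb Z\}$ be the hyperbolic Penrose tiling. Collections of tiles carry the tiling topology, generated by $$\delta(T,T')=\inf\Big(\big\{\tfrac1{\sqrt2}\big\}\cup\big\{\varepsilon\in(0,\tfrac1{\sqrt2}] : \exists g\in G,\ d(g,\mathrm{Id})<\varepsilon,\ gT\cap B_{1/\varepsilon}=T'\cap B_{1/\varepsilon}\big\}\Big),$$ where $B_\rho$ is the open ball of radius $\rho$ around $i$ and $T\cap B_\rho$ is the set of tiles of $T$ that meet $B_\rho$. Let $X^{\mathcal N}_{\mathcal P}$ be the closure of $\{\mathcal P+s : s\in\mathbb R\}$ in this topology. The group $\mathbb R$ acts on it by translations $T\mapsto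 T+s$, and $R$ acts on it by $T\mapsto R.T$. (This $\mathbb R$-action is conjugate to the suspension of the dyadic odometer.) Let $r\ge 1$, let $w\in\{1,\dots,r\}^{\mathbb Z}$, let $\sigma$ be the shift $(w_n)_n\mapsto(w_{n+1})_n$, and let $Z_w=\overline{\{\sigma^n(w):n\in\mathbb Z\}}$. On $X^{\mathcal N}_{\mathcal P}\times Z_w\times\mathbb R^*_+$ with the product topology let $\mathcal R(T,w',t)=(R.T,\sigma(w'),t/2)$, and let $g:z\mapsto az+b$ in $G$ act by $g.(T,w',t)=(T+\tfrac{b}{at},w',at)$. This action commutes with $\mathcal R$ and hence induces an action of $G$ on the double suspension $(X^{\mathcal N}_{\mathcal P}\times Z_w\times\mathbb R^*_+)/\mathcal R$, the quotient by the orbits of $\mathcal R$. Let $\pi$ denote the projection onto this quotient, and let $m$ be a Haar measure of the multiplicative group $\mathbb R^*_+$. All measures are Borel measures. **Proposition.** There is exactly one translation-invariant probability measure $\nu$ on $X^{\mathcal N}_{\mathcal P}$. For every finite $G$-invariant measure $\theta$ on $(X^{\mathcal N}_{\mathcal P}\times Z_w\times\mathbb R^*_+)/\mathcal R$ there is a finite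 $\sigma$-invariant measure $\mu$ on $Z_w$ such that $\theta$ is locally the image of $\nu\otimes\mu\otimes m$ through $\pi$: every point of $X^{\mathcal N}_{\mathcal P}\times Z_w\times\mathbb R^*_+$ has an open neighbourhood $U$ which $\pi$ maps homeomorphically onto an open set, and $$\theta|_{\pi(U)}=\pi_*\big((\nu\otimes\mu\otimes m)|_U\big).$$ -/

import Mathlib

open MeasureTheory Topology TopologicalSpace
open scoped UpperHalfPlane

namespace HypPenrose

noncomputable section

/-- The multiplicative group `ℝ*₊`. -/
abbrev PosReal : Type := {x : ℝ // 0 < x}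

/-! ### The group `G` of affine transformations `z ↦ a z + b`, `a > 0`, of the half-plane -/

/-- The element `⟨a, b⟩` stands for `z ↦ a z + b`. -/
@[ext]
structure AffGroup where
  a : PosReal
  b : ℝ

namespace AffGroup

/-- Composition of transformations: `a (a' z + b') + b = (a a') z + (a b' + b)`. -/
instance : Group AffGroup where
  mul g h := ⟨g.a * h.a, g.a * h.b + g.b⟩
  one := ⟨1, 0⟩
  inv g := ⟨g.a⁻¹, -((g.a⁻¹ : PosReal) : ℝ) * g.b⟩
  mul_assoc g h k := by
    apply AffGroup.ext
    · exact mul_assoc g.a h.a k.a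
    · change ((g.a * h.a : PosReal) : ℝ) * k.b + (g.a * h.b + g.b)
        = g.a * (h.a * k.b + h.b) + g.b
      rw [Positive.val_mul]
      ring
  one_mul g := by
    apply AffGroup.ext
    · exact one_mul g.a
    · change ((1 : PosReal) : ℝ) * g.b + 0 = g.b
      simp
  mul_one g := by
    apply AffGroup.ext
    · exact mul_one g.a
    · change (g.a : ℝ) * 0 + g.b = g.b
      simp
  inv_mul_cancel g := by
    apply AffGroup.ext
    · exact inv_mul_cancel g.a
    · change ((g.a⁻¹ : PosReal) : ℝ) * g.b + -((g.a⁻¹ : PosReal) : ℝ) * g.b = 0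
      ring

theorem mul_a (g h : AffGroup) : (g * h).a = g.a * h.a := rfl
theorem mul_b (g h : AffGroup) : (g * h).b = g.a * h.b + g.b := rfl
theorem one_a : (1 : AffGroup).a = 1 := rfl
theorem one_b : (1 : AffGroup).b = 0 := rfl
theorem inv_a (g : AffGroup) : (g⁻¹).a = g.a⁻¹ := rfl

/-- `G` acts on the upper half-plane by `z ↦ a z + b`. -/
instance : MulAction AffGroup ℍ where
  smul g z := g.b +ᵥ (g.a • z)
  one_smul z := by
    change (0 : ℝ) +ᵥ ((1 : PosReal) • z) = z
    simp
  mul_smul g h z := by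
    change (g.a * h.b + g.b : ℝ) +ᵥ ((g.a * h.a : PosReal) • z)
      = g.b +ᵥ (g.a • (h.b +ᵥ (h.a • z)))
    apply UpperHalfPlane.ext
    simp only [UpperHalfPlane.coe_vadd, UpperHalfPlane.coe_pos_real_smul, Complex.real_smul,
      Positive.val_mul]
    push_cast
    ring

theorem smul_def (g : AffGroup) (z : ℍ) : g • z = g.b +ᵥ (g.a • z) := rfl

theorem isometry_smul (g : AffGroup) : Isometry (fun z : ℍ => g • z) :=
  (UpperHalfPlane.isometry_real_vadd g.b).comp (UpperHalfPlane.isometry_pos_mul g.a)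

/-- The translation `z ↦ z + s`; these form the subgroup `𝒩 ≅ ℝ`. -/
def translation (s : ℝ) : AffGroup := ⟨1, s⟩

/-- `R : z ↦ 2 z`. -/
def R : AffGroup := ⟨⟨2, two_pos⟩, 0⟩

/-- `S : z ↦ z + 1`. -/
def S : AffGroup := translation 1

theorem translation_zero : translation 0 = 1 := rfl

theorem translation_add (s t : ℝ) : translation (s + t) = translation s * translation t := by
  apply AffGroup.ext
  · simp [translation, mul_a]
  · simp [translation, mul_b, add_comm]

theorem R_mul_translation (s : ℝ) : R * translation s = translation (2 * s) * R := by
  apply AffGroup.ext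
  · simp [translation, mul_a]
  · simp [translation, mul_b, R]

theorem R_inv_mul_translation (s : ℝ) : R⁻¹ * translation s = translation (s / 2) * R⁻¹ := by
  rw [inv_mul_eq_iff_eq_mul, ← mul_assoc, R_mul_translation]
  simp [mul_assoc, mul_div_cancel₀]

end AffGroup

/-! ### Collections of tiles and the tiling topology -/

/-- A collection of tiles, each tile being a nonempty compact subset of the half-plane. -/
@[ext]
structure TileSet where
  tiles : Set (NonemptyCompacts ℍ)

/-- The image of a tile under an element of `G`. -/
def tileImage (g : AffGroup) (K : NonemptyCompacts ℍ) : NonemptyCompacts ℍ :=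
  K.map (fun z => g • z) g.isometry_smul.continuous

theorem coe_tileImage (g : AffGroup) (K : NonemptyCompacts ℍ) :
    (tileImage g K : Set ℍ) = (fun z => g • z) '' K := rfl

theorem tileImage_one (K : NonemptyCompacts ℍ) : tileImage 1 K = K := by
  apply SetLike.coe_injective
  simp [coe_tileImage]

theorem tileImage_mul (g h : AffGroup) (K : NonemptyCompacts ℍ) :
    tileImage (g * h) K = tileImage g (tileImage h K) := by
  apply SetLike.coe_injective
  simp [coe_tileImage, Set.image_image, mul_smul]

namespace TileSet

instance : MulAction AffGroup TileSet where
  smul g T := ⟨tileImage g '' T.tiles⟩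
  one_smul T := by
    apply TileSet.ext
    change tileImage 1 '' T.tiles = T.tiles
    simp [tileImage_one]
  mul_smul g h T := by
    apply TileSet.ext
    change tileImage (g * h) '' T.tiles = tileImage g '' (tileImage h '' T.tiles)
    simp [Set.image_image, tileImage_mul]

theorem smul_tiles (g : AffGroup) (T : TileSet) : (g • T).tiles = tileImage g '' T.tiles := rfl

/-- The patch `T ∩ B_ρ`: the tiles of `T` that meet the open ball of radius `ρ` around `i`. -/
def patch (T : TileSet) (ρ : ℝ) : Set (NonemptyCompacts ℍ) :=
  {K ∈ T.tiles | ((K : Set ℍ) ∩ Metric.ball UpperHalfPlane.I ρ).Nonempty}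

/-- The set of `ε ∈ (0, 1/√2]` such that `g T` and `T'` agree on `B_{1/ε}` for some `g ∈ G` at
distance less than `ε` from the identity; `G` carries the left-invariant metric
`d(g, h) = d(g i, h i)`. -/
def closeness (T T' : TileSet) : Set ℝ :=
  {ε | 0 < ε ∧ ε ≤ 1 / √2 ∧ ∃ g : AffGroup,
    dist (g • UpperHalfPlane.I) UpperHalfPlane.I < ε ∧ (g • T).patch (1 / ε) = T'.patch (1 / ε)}

/-- The distance `δ` of the tiling topology: the infimum of `closeness T T'`, or `1/√2` if that
set is empty. -/
def δ (T T' : TileSet) : ℝ := sInf (insert (1 / √2) (closeness T T'))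

/-- The tiling topology: the topology generated by `δ`. -/
instance : TopologicalSpace TileSet where
  IsOpen U := ∀ T ∈ U, ∃ ε > 0, ∀ T', δ T T' < ε → T' ∈ U
  isOpen_univ _ _ := ⟨1, one_pos, fun _ _ => trivial⟩
  isOpen_inter U V hU hV T hT := by
    obtain ⟨ε, hε, h⟩ := hU T hT.1
    obtain ⟨ε', hε', h'⟩ := hV T hT.2
    exact ⟨min ε ε', lt_min hε hε', fun T' hT' =>
      ⟨h T' (hT'.trans_le (min_le_left _ _)), h' T' (hT'.trans_le (min_le_right _ _))⟩⟩
  isOpen_sUnion 𝒰 h T hT := by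
    obtain ⟨U, hU, hTU⟩ := hT
    obtain ⟨ε, hε, h'⟩ := h U hU T hTU
    exact ⟨ε, hε, fun T' hT' => ⟨U, hU, h' T' hT'⟩⟩

theorem isOpen_def (U : Set TileSet) :
    IsOpen U ↔ ∀ T ∈ U, ∃ ε > 0, ∀ T', δ T T' < ε → T' ∈ U := Iff.rfl

theorem δ_lt_iff {T T' : TileSet} {ε : ℝ} :
    δ T T' < ε ↔ 1 / √2 < ε ∨ ∃ η ∈ closeness T T', η < ε := by
  have hb : BddBelow (insert (1 / √2) (closeness T T')) := by
    refine ⟨0, ?_⟩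
    rintro x (rfl | hx)
    · positivity
    · exact hx.1.le
  rw [δ, csInf_lt_iff hb (Set.insert_nonempty _ _)]
  simp

theorem patch_smul (g : AffGroup) (T : TileSet) (K : NonemptyCompacts ℍ) (ρ : ℝ) :
    K ∈ (g • T).patch ρ ↔ ∃ L ∈ T.tiles, tileImage g L = K ∧
      ((L : Set ℍ) ∩ Metric.ball (g⁻¹ • UpperHalfPlane.I) ρ).Nonempty := by
  have key : ∀ L : NonemptyCompacts ℍ,
      (((tileImage g L : NonemptyCompacts ℍ) : Set ℍ) ∩
        Metric.ball UpperHalfPlane.I ρ).Nonempty ↔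
      ((L : Set ℍ) ∩ Metric.ball (g⁻¹ • UpperHalfPlane.I) ρ).Nonempty := by
    intro L
    have hd : ∀ z : ℍ, dist (g • z) UpperHalfPlane.I = dist z (g⁻¹ • UpperHalfPlane.I) := by
      intro z
      have := g.isometry_smul.dist_eq z (g⁻¹ • UpperHalfPlane.I)
      simpa using this
    rw [coe_tileImage]
    constructor
    · rintro ⟨_, ⟨z, hz, rfl⟩, hzb⟩
      exact ⟨z, hz, by simpa [Metric.mem_ball, hd] using hzb⟩
    · rintro ⟨z, hz, hzb⟩
      exact ⟨g • z, ⟨z, hz, rfl⟩, by simpa [Metric.mem_ball, hd] using hzb⟩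
  constructor
  · rintro ⟨⟨L, hL, rfl⟩, h⟩
    exact ⟨L, hL, rfl, (key L).1 h⟩
  · rintro ⟨L, hL, rfl, h⟩
    exact ⟨⟨L, hL, rfl⟩, (key L).2 h⟩

/-- Elements of `G` that move `i` little move any given point little. -/
theorem exists_dist_smul_lt (z : ℍ) {ε : ℝ} (hε : 0 < ε) : ∃ η > 0, ∀ g : AffGroup,
    dist (g • UpperHalfPlane.I) UpperHalfPlane.I < η → dist (g • z) z < ε := by
  let F : ℍ → ℍ := fun p => p.re +ᵥ ((⟨p.im, p.im_pos⟩ : PosReal) • z)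
  have hF : Continuous F := by
    rw [UpperHalfPlane.isEmbedding_coe.continuous_iff]
    have : (UpperHalfPlane.coe ∘ F) = fun p : ℍ => ((p.re : ℂ) + (p.im : ℝ) • (z : ℂ)) := by
      funext p
      simp [F]
    rw [this]
    have h1 : Continuous fun p : ℍ => p.re := UpperHalfPlane.continuous_re
    have h2 : Continuous fun p : ℍ => p.im := UpperHalfPlane.continuous_im
    fun_prop
  have hI : F UpperHalfPlane.I = z := by
    apply UpperHalfPlane.ext
    simp [F]
  have hg : ∀ g : AffGroup, F (g • UpperHalfPlane.I) = g • z := by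
    intro g
    apply UpperHalfPlane.ext
    simp [F, AffGroup.smul_def]
  obtain ⟨η, hη, h⟩ := Metric.continuous_iff.1 hF UpperHalfPlane.I ε hε
  refine ⟨η, hη, fun g hgη => ?_⟩
  have := h _ hgη
  rwa [hg, hI] at this

theorem continuous_smul (h : AffGroup) : Continuous (fun T : TileSet => h • T) := by
  refine ⟨fun U hU => ?_⟩
  rw [isOpen_def] at hU ⊢
  intro T hT
  obtain ⟨ε, hε, hball⟩ := hU (h • T) hT
  set ε₁ : ℝ := min (ε / 2) (1 / √2) with hε₁
  have hε₁0 : 0 < ε₁ := lt_min (by positivity) (by positivity)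
  set D : ℝ := dist (h⁻¹ • UpperHalfPlane.I) UpperHalfPlane.I
  have hD : 0 ≤ D := dist_nonneg
  obtain ⟨η, hη, hmove⟩ := exists_dist_smul_lt (h⁻¹ • UpperHalfPlane.I) hε₁0
  have hden : 0 < 1 / ε₁ + D := by positivity
  refine ⟨min η (min (1 / √2) (1 / (1 / ε₁ + D))),
    lt_min hη (lt_min (by positivity) (by positivity)), fun T' hT' => ?_⟩
  apply hball
  rw [δ_lt_iff] at hT' ⊢
  right
  obtain hbad | ⟨κ, ⟨hκ0, hκ, g, hgκ, hpatch⟩, hκlt⟩ := hT'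
  · exact absurd hbad (not_lt.2 ((min_le_right _ _).trans (min_le_left _ _)))
  have hκη : κ < η := hκlt.trans_le (min_le_left _ _)
  have hκr : 1 / ε₁ + D ≤ 1 / κ := by
    rw [le_one_div hden hκ0]
    exact (hκlt.trans_le ((min_le_right _ _).trans (min_le_right _ _))).le
  refine ⟨ε₁, ⟨hε₁0, min_le_right _ _, h * g * h⁻¹, ?_, ?_⟩,
    (min_le_left _ _).trans_lt (by linarith)⟩
  · have h1 := hmove g (hgκ.trans hκη)
    have h2 := h.isometry_smul.dist_eq (g • h⁻¹ • UpperHalfPlane.I) (h⁻¹ • UpperHalfPlane.I)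
    simp only [smul_inv_smul] at h2
    rw [mul_smul, mul_smul, h2]
    exact h1
  · have e : (h * g * h⁻¹) • h • T = h • g • T := by
      simp [mul_smul]
    rw [e]
    ext K
    rw [patch_smul, patch_smul]
    have sub : Metric.ball (h⁻¹ • UpperHalfPlane.I) (1 / ε₁) ⊆
        Metric.ball UpperHalfPlane.I (1 / κ) :=
      Metric.ball_subset_ball' hκr
    have hiff : ∀ L : NonemptyCompacts ℍ,
        ((L : Set ℍ) ∩ Metric.ball (h⁻¹ • UpperHalfPlane.I) (1 / ε₁)).Nonempty →
        (L ∈ (g • T).tiles ↔ L ∈ T'.tiles) := by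
      intro L hL
      have hL' := hL.mono (Set.inter_subset_inter_right _ sub)
      have := Set.ext_iff.1 hpatch L
      constructor
      · exact fun hm => (this.1 ⟨hm, hL'⟩).1
      · exact fun hm => (this.2 ⟨hm, hL'⟩).1
    constructor
    · rintro ⟨L, hL, hK, hne⟩
      exact ⟨L, (hiff L hne).1 hL, hK, hne⟩
    · rintro ⟨L, hL, hK, hne⟩
      exact ⟨L, (hiff L hne).2 hL, hK, hne⟩

end TileSet

/-! ### The hyperbolic Penrose tiling and the closure of its `𝒩`-orbit -/

/-- The convex hyperbolic pentagon with vertices `i`, `1/2 + i`, `1 + i`, `1 + 2i`, `2i`, as the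
intersection of the half-planes bounded by the geodesics that carry its edges: the vertical lines
through `0` and `1`, and the half-circles centred on the real axis through `i` and `1/2 + i`,
through `1/2 + i` and `1 + i`, and through `2i` and `1 + 2i`. -/
def pentagon : Set ℍ :=
  {z | 0 ≤ z.re ∧ z.re ≤ 1 ∧
    17 / 16 ≤ (z.re - 1 / 4) ^ 2 + z.im ^ 2 ∧
    17 / 16 ≤ (z.re - 3 / 4) ^ 2 + z.im ^ 2 ∧
    (z.re - 1 / 2) ^ 2 + z.im ^ 2 ≤ 17 / 4}

theorem isCompact_pentagon : IsCompact pentagon := by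
  rw [UpperHalfPlane.isEmbedding_coe.isCompact_iff]
  have himg : UpperHalfPlane.coe '' pentagon =
      {z : ℂ | 0 ≤ z.re ∧ z.re ≤ 1 ∧ 17 / 16 ≤ (z.re - 1 / 4) ^ 2 + z.im ^ 2 ∧
        17 / 16 ≤ (z.re - 3 / 4) ^ 2 + z.im ^ 2 ∧
        (z.re - 1 / 2) ^ 2 + z.im ^ 2 ≤ 17 / 4 ∧ 0 ≤ z.im} := by
    ext z
    constructor
    · rintro ⟨w, ⟨h1, h2, h3, h4, h5⟩, rfl⟩
      exact ⟨h1, h2, h3, h4, h5, w.im_pos.le⟩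
    · rintro ⟨h1, h2, h3, h4, h5, h6⟩
      have hz : 0 < z.im := by
        rcases h6.lt_or_eq with h | h
        · exact h
        · exfalso
          rw [← h] at h3 h4
          rcases le_total z.re (1 / 2) with hx | hx <;> nlinarith
      exact ⟨⟨z, hz⟩, ⟨h1, h2, h3, h4, h5⟩, rfl⟩
  rw [himg]
  apply Metric.isCompact_of_isClosed_isBounded
  · have c1 := Complex.continuous_re
    have c2 := Complex.continuous_im
    have k3 : Continuous fun z : ℂ => (z.re - 1 / 4) ^ 2 + z.im ^ 2 := by fun_prop
    have k4 : Continuous fun z : ℂ => (z.re - 3 / 4) ^ 2 + z.im ^ 2 := by fun_prop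
    have k5 : Continuous fun z : ℂ => (z.re - 1 / 2) ^ 2 + z.im ^ 2 := by fun_prop
    exact (isClosed_le continuous_const c1).and <| (isClosed_le c1 continuous_const).and <|
      (isClosed_le continuous_const k3).and <| (isClosed_le continuous_const k4).and <|
      (isClosed_le k5 continuous_const).and <| isClosed_le continuous_const c2
  · refine (Metric.isBounded_closedBall (x := (0 : ℂ)) (r := 4)).subset ?_
    rintro z ⟨h1, h2, h3, h4, h5, h6⟩
    rw [mem_closedBall_zero_iff]
    refine (Complex.norm_le_abs_re_add_abs_im z).trans ?_
    rw [abs_of_nonneg h1, abs_of_nonneg h6]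
    nlinarith [sq_nonneg (z.re - 1 / 2)]

theorem nonempty_pentagon : pentagon.Nonempty := by
  refine ⟨UpperHalfPlane.I, ?_⟩
  simp only [pentagon, Set.mem_ofPred_eq, UpperHalfPlane.I_re, UpperHalfPlane.I_im]
  norm_num

/-- The prototile `P`. -/
def prototile : NonemptyCompacts ℍ := ⟨⟨pentagon, isCompact_pentagon⟩, nonempty_pentagon⟩

/-- The hyperbolic Penrose tiling `𝒫 = {R^k S^n P | n, k ∈ ℤ}`. -/
def penrose : TileSet :=
  ⟨{K | ∃ k n : ℤ, K = tileImage (AffGroup.R ^ k * AffGroup.S ^ n) prototile}⟩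

theorem R_zpow_smul_penrose (j : ℤ) : (AffGroup.R ^ j) • penrose = penrose := by
  apply TileSet.ext
  rw [TileSet.smul_tiles]
  ext K
  constructor
  · rintro ⟨_, ⟨k, n, rfl⟩, rfl⟩
    exact ⟨j + k, n, by rw [← tileImage_mul, zpow_add, mul_assoc]⟩
  · rintro ⟨k, n, rfl⟩
    exact ⟨_, ⟨-j + k, n, rfl⟩, by rw [← tileImage_mul, zpow_add]; group⟩

/-- The orbit `𝒩.𝒫` of the Penrose tiling under the translations. -/
def orbitN : Set TileSet := Set.range fun s : ℝ => AffGroup.translation s • penrose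

/-- `X^𝒩_𝒫`: the closure of `𝒩.𝒫` for the tiling topology. -/
def HullN : Type := ↥(closure orbitN)

namespace HullN

instance : TopologicalSpace HullN := inferInstanceAs (TopologicalSpace ↥(closure orbitN))

/-- Measures on the hull are Borel measures. -/
instance : MeasurableSpace HullN := borel HullN

instance : BorelSpace HullN := ⟨rfl⟩

theorem translation_mem (s : ℝ) {T : TileSet} (hT : T ∈ closure orbitN) :
    AffGroup.translation s • T ∈ closure orbitN := by
  refine map_mem_closure (TileSet.continuous_smul _) hT ?_
  rintro _ ⟨t, rfl⟩
  exact ⟨s + t, by simp [AffGroup.translation_add, mul_smul]⟩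

theorem R_mem {T : TileSet} (hT : T ∈ closure orbitN) : AffGroup.R • T ∈ closure orbitN := by
  refine map_mem_closure (TileSet.continuous_smul _) hT ?_
  rintro _ ⟨t, rfl⟩
  refine ⟨2 * t, ?_⟩
  change _ = AffGroup.R • AffGroup.translation t • penrose
  rw [smul_smul, AffGroup.R_mul_translation, mul_smul]
  have := R_zpow_smul_penrose 1
  rw [zpow_one] at this
  rw [this]

theorem R_inv_mem {T : TileSet} (hT : T ∈ closure orbitN) :
    AffGroup.R⁻¹ • T ∈ closure orbitN := by
  refine map_mem_closure (TileSet.continuous_smul _) hT ?_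
  rintro _ ⟨t, rfl⟩
  refine ⟨t / 2, ?_⟩
  change _ = AffGroup.R⁻¹ • AffGroup.translation t • penrose
  rw [smul_smul, AffGroup.R_inv_mul_translation, mul_smul]
  have := R_zpow_smul_penrose (-1)
  rw [zpow_neg_one] at this
  rw [this]

/-- `ℝ ≅ 𝒩` acts on `X^𝒩_𝒫` by translations; `s +ᵥ T` is the tiling `T + s`. -/
instance : AddAction ℝ HullN where
  vadd s T := ⟨AffGroup.translation s • T.1, translation_mem s T.2⟩
  zero_vadd T := Subtype.ext (by
    change AffGroup.translation 0 • T.1 = T.1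
    rw [AffGroup.translation_zero, one_smul])
  add_vadd s t T := Subtype.ext (by
    change AffGroup.translation (s + t) • T.1
      = AffGroup.translation s • AffGroup.translation t • T.1
    rw [AffGroup.translation_add, mul_smul])

/-- The bijection `T ↦ R.T` of `X^𝒩_𝒫`. -/
def R : Equiv.Perm HullN where
  toFun T := ⟨AffGroup.R • T.1, R_mem T.2⟩
  invFun T := ⟨AffGroup.R⁻¹ • T.1, R_inv_mem T.2⟩
  left_inv _ := Subtype.ext (inv_smul_smul _ _)
  right_inv _ := Subtype.ext (smul_inv_smul _ _)

theorem R_vadd (s : ℝ) (T : HullN) : R (s +ᵥ T) = (2 * s) +ᵥ R T := Subtype.ext (by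
  change AffGroup.R • AffGroup.translation s • T.1
    = AffGroup.translation (2 * s) • AffGroup.R • T.1
  rw [smul_smul, smul_smul, AffGroup.R_mul_translation])

end HullN

/-! ### The subshift `Z_w` -/

/-- The shift `(w_n) ↦ (w_{n+1})` on sequences in a finite alphabet with `r` letters. -/
def shift (r : ℕ) : (ℤ → Fin r) ≃ₜ (ℤ → Fin r) where
  toFun w n := w (n + 1)
  invFun w n := w (n - 1)
  left_inv w := by funext n; simp
  right_inv w := by funext n; simp
  continuous_toFun := by fun_prop
  continuous_invFun := by fun_prop

/-- `Z_w`: the closure of the shift orbit of `w` in the product topology. -/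
abbrev Subshift {r : ℕ} (w : ℤ → Fin r) : Type :=
  ↥(closure (Set.range fun n : ℤ => ((shift r).toEquiv ^ n : Equiv.Perm (ℤ → Fin r)) w))

/-- The shift `σ` as a bijection of `Z_w`. -/
def subshiftMap {r : ℕ} (w : ℤ → Fin r) : Equiv.Perm (Subshift w) where
  toFun x := ⟨shift r x.1, map_mem_closure (shift r).continuous x.2 (by
    rintro _ ⟨n, rfl⟩
    exact ⟨1 + n, by
      change ((shift r).toEquiv ^ (1 + n) : Equiv.Perm (ℤ → Fin r)) w = _
      rw [zpow_add, zpow_one]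
      rfl⟩)⟩
  invFun x := ⟨(shift r).symm x.1, map_mem_closure (shift r).symm.continuous x.2 (by
    rintro _ ⟨n, rfl⟩
    exact ⟨-1 + n, by
      change ((shift r).toEquiv ^ (-1 + n) : Equiv.Perm (ℤ → Fin r)) w = _
      rw [zpow_add, zpow_neg_one]
      rfl⟩)⟩
  left_inv x := Subtype.ext ((shift r).symm_apply_apply x.1)
  right_inv x := Subtype.ext ((shift r).apply_symm_apply x.1)

/-! ### The double suspension -/

/-- `X^𝒩_𝒫 × Z_w × ℝ*₊`. -/
abbrev TotalSpace {r : ℕ} (w : ℤ → Fin r) : Type := HullN × Subshift w × PosReal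

/-- `ℛ(T, w', t) = (R.T, σ(w'), t / 2)`. -/
def suspMap {r : ℕ} (w : ℤ → Fin r) : Equiv.Perm (TotalSpace w) :=
  HullN.R.prodCongr ((subshiftMap w).prodCongr (Equiv.divRight (⟨2, two_pos⟩ : PosReal)))

/-- The double suspension `(X^𝒩_𝒫 × Z_w × ℝ*₊) / ℛ`: the quotient by the orbits of `ℛ`. -/
def DoubleSuspension {r : ℕ} (w : ℤ → Fin r) : Type :=
  Quotient (Equiv.Perm.SameCycle.setoid (suspMap w))

/-- An element `g : z ↦ a z + b` of `G` acts on `X^𝒩_𝒫 × Z_w × ℝ*₊` by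
`(T, w', t) ↦ (T + b / (a t), w', a t)`. -/
def totalAct {r : ℕ} (w : ℤ → Fin r) (g : AffGroup) (x : TotalSpace w) : TotalSpace w :=
  ((g.b / (g.a * x.2.2)) +ᵥ x.1, x.2.1, g.a * x.2.2)

theorem totalAct_one {r : ℕ} (w : ℤ → Fin r) (x : TotalSpace w) : totalAct w 1 x = x := by
  simp [totalAct, AffGroup.one_a, AffGroup.one_b]

theorem totalAct_mul {r : ℕ} (w : ℤ → Fin r) (g h : AffGroup) (x : TotalSpace w) :
    totalAct w (g * h) x = totalAct w g (totalAct w h x) := by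
  obtain ⟨T, v, t⟩ := x
  have h1 : (g.a : ℝ) ≠ 0 := g.a.2.ne'
  have h2 : (h.a : ℝ) ≠ 0 := h.a.2.ne'
  have h3 : (t : ℝ) ≠ 0 := t.2.ne'
  refine Prod.ext ?_ (Prod.ext rfl (mul_assoc g.a h.a t))
  simp only [totalAct, AffGroup.mul_a, AffGroup.mul_b, vadd_vadd, Positive.val_mul]
  congr 1
  field_simp
  ring

theorem suspMap_totalAct {r : ℕ} (w : ℤ → Fin r) (g : AffGroup) (x : TotalSpace w) :
    suspMap w (totalAct w g x) = totalAct w g (suspMap w x) := by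
  obtain ⟨T, v, t⟩ := x
  have h1 : (g.a : ℝ) ≠ 0 := g.a.2.ne'
  have h3 : (t : ℝ) ≠ 0 := t.2.ne'
  refine Prod.ext ?_ (Prod.ext rfl (mul_div_assoc g.a t _))
  change HullN.R ((g.b / (g.a * t)) +ᵥ T)
    = (g.b / (g.a * ((t / ⟨2, two_pos⟩ : PosReal) : ℝ))) +ᵥ HullN.R T
  rw [HullN.R_vadd]
  congr 1
  have : ((t / ⟨2, two_pos⟩ : PosReal) : ℝ) = t / 2 := by
    simp [div_eq_mul_inv]
  rw [this]
  field_simp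

theorem suspMap_zpow_totalAct {r : ℕ} (w : ℤ → Fin r) (g : AffGroup) (n : ℤ)
    (x : TotalSpace w) :
    (suspMap w ^ n) (totalAct w g x) = totalAct w g ((suspMap w ^ n) x) := by
  have hs : ∀ y, (suspMap w)⁻¹ (totalAct w g y) = totalAct w g ((suspMap w)⁻¹ y) := by
    intro y
    rw [Equiv.Perm.inv_eq_iff_eq, suspMap_totalAct]
    exact congrArg (totalAct w g) ((suspMap w).apply_symm_apply y).symm
  induction n with
  | zero => simp
  | succ n ih =>
    rw [add_comm, zpow_add, zpow_one, Equiv.Perm.mul_apply, ih, suspMap_totalAct,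
      Equiv.Perm.mul_apply]
  | pred n ih =>
    rw [sub_eq_neg_add, zpow_add, zpow_neg_one, Equiv.Perm.mul_apply, ih, hs,
      Equiv.Perm.mul_apply]

namespace DoubleSuspension

variable {r : ℕ} (w : ℤ → Fin r)

instance : TopologicalSpace (DoubleSuspension w) :=
  inferInstanceAs (TopologicalSpace (Quotient (Equiv.Perm.SameCycle.setoid (suspMap w))))

/-- Measures on the double suspension are Borel measures. -/
instance : MeasurableSpace (DoubleSuspension w) := borel (DoubleSuspension w)

instance : BorelSpace (DoubleSuspension w) := ⟨rfl⟩

/-- The canonical projection `π`. -/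
def proj (x : TotalSpace w) : DoubleSuspension w := Quotient.mk _ x

/-- The action of `G` induced on the double suspension. -/
instance : MulAction AffGroup (DoubleSuspension w) where
  smul g := Quotient.map (totalAct w g) (by
    rintro x _ ⟨n, rfl⟩
    exact ⟨n, suspMap_zpow_totalAct w g n x⟩)
  one_smul p := by
    induction p using Quotient.inductionOn with
    | h x => exact congrArg (proj w) (totalAct_one w x)
  mul_smul g h p := by
    induction p using Quotient.inductionOn with
    | h x => exact congrArg (proj w) (totalAct_mul w g h x)

theorem smul_proj (g : AffGroup) (x : TotalSpace w) :
    g • proj w x = proj w (totalAct w g x) := rfl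

/-- The measure `θ` is locally the image of `η` through the projection: every point of the total
space has an open neighbourhood `U` that the projection maps homeomorphically onto an open set, and
the restriction of `θ` to the image of `U` is the image of the restriction of `η` to `U`. -/
def IsLocallyImage (θ : Measure (DoubleSuspension w)) (η : Measure (TotalSpace w)) : Prop :=
  ∀ x : TotalSpace w, ∃ U : Set (TotalSpace w), IsOpen U ∧ x ∈ U ∧
    IsOpenEmbedding (U.domRestrict (proj w)) ∧
    θ.restrict (proj w '' U) = (η.restrict U).map (proj w)

end DoubleSuspension

/-- `ν` is the only probability measure on `X^𝒩_𝒫` that is invariant under the translations. -/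
def IsUniqueInvariantProbability (ν : Measure HullN) : Prop :=
  IsProbabilityMeasure ν ∧ VAddInvariantMeasure ℝ HullN ν ∧
    ∀ ν' : Measure HullN, IsProbabilityMeasure ν' → VAddInvariantMeasure ℝ HullN ν' → ν' = ν

end

end HypPenrose

/-!
A tiling of the hull is determined by the horizontal offsets of its rows, each taken modulo the
width of the tiles of that row. Consecutive offsets are related by doubling, so they form a point of
the dyadic solenoid, on which the translations act along a dense one-parameter subgroup. A finite
measure that is invariant under a dense subgroup is invariant under the whole solenoid, hence a
multiple of its Haar measure, whose image is `ν`.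

A finite invariant measure `θ` on the double suspension pulls back along the local homeomorphism `π`
to a measure invariant under `G` and `ℛ`. Invariance under the dilations splits off a factor `m` by
uniqueness of the Haar measure. The translation by `b` moves the fibre of height `t` by `b / t`;
as the remaining factor does not depend on `t`, continuity in `t` makes it invariant under each
individual translation, and unique ergodicity splits off `ν`. The last factor inherits the
invariance under `σ` from the invariance of the pullback under `ℛ`.
-/

namespace HypPenrose

open UpperHalfPlane (I)
open scoped ENNReal NNReal BoundedContinuousFunction

noncomputable section

/-! ### Invariant measures and product measures -/

section InvarianceOfMeasures

variable {T X : Type*} [TopologicalSpace T] [TopologicalSpace X]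
  [MeasurableSpace X] [BorelSpace X]

theorem continuous_lintegral_comp [FirstCountableTopology T] (κ : Measure X) [IsFiniteMeasure κ]
    {φ : T → X → X} (hφ : Continuous φ.uncurry) (f : X →ᵇ ℝ≥0) :
    Continuous fun t => ∫⁻ x, f (φ t x) ∂κ := by
  refine continuous_iff_continuousAt.2 fun t =>
    tendsto_lintegral_filter_of_dominated_convergence (fun _ => (nndist f 0 : ℝ≥0∞)) ?_ ?_ ?_ ?_
  · exact .of_forall fun s => f.measurable_coe_ennreal_comp.comp (hφ.uncurry_left s).measurable
  · exact .of_forall fun s => .of_forall fun x =>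
        ENNReal.coe_le_coe.2 (BoundedContinuousFunction.NNReal.upper_bound f _)
  · simp [lintegral_const, ENNReal.mul_eq_top]
  · exact .of_forall fun x => (ENNReal.continuous_coe.comp (f.continuous.comp
      (hφ.uncurry_right x))).tendsto t

theorem map_eq_iff_forall_lintegral_eq [HasOuterApproxClosed X] {κ : Measure X}
    [IsFiniteMeasure κ] {φ : X → X} (hφ : Measurable φ) :
    κ.map φ = κ ↔ ∀ f : X →ᵇ ℝ≥0, ∫⁻ x, f (φ x) ∂κ = ∫⁻ x, f x ∂κ := by
  have change_of_variable (f : X →ᵇ ℝ≥0) : ∫⁻ x, f x ∂κ.map φ = ∫⁻ x, f (φ x) ∂κ :=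
    lintegral_map f.measurable_coe_ennreal_comp hφ
  refine ⟨fun h f => by rw [← change_of_variable, h], fun h => ?_⟩
  exact ext_of_forall_lintegral_eq_of_IsFiniteMeasure fun f => by rw [change_of_variable, h]

theorem isClosed_setOf_map_eq [FirstCountableTopology T] [HasOuterApproxClosed X]
    (κ : Measure X) [IsFiniteMeasure κ] {φ : T → X → X} (hφ : Continuous φ.uncurry) :
    IsClosed {t | κ.map (φ t) = κ} := by
  simp only [fun t => map_eq_iff_forall_lintegral_eq (κ := κ) (hφ.uncurry_left t).measurable,
    Set.ofPred_forall]
  exact isClosed_iInter fun f => isClosed_eq (continuous_lintegral_comp κ hφ f) continuous_const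

theorem isAddLeftInvariant_of_dense {G : Type*} [AddGroup G] [TopologicalSpace G]
    [ContinuousAdd G] [FirstCountableTopology G] [MeasurableSpace G] [BorelSpace G]
    [HasOuterApproxClosed G] (κ : Measure G) [IsFiniteMeasure κ] {D : Set G} (hD : Dense D)
    (h : ∀ g ∈ D, κ.map (g + ·) = κ) : κ.IsAddLeftInvariant where
  map_add_left_eq_self g := by
    have hclosed : IsClosed {g : G | κ.map (g + ·) = κ} := isClosed_setOf_map_eq κ continuous_add
    exact closure_minimal h hclosed (hD g)

theorem forall_map_eq_of_measurePreserving_prod [FirstCountableTopology T] [MeasurableSpace T]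
    [BorelSpace T] [HasOuterApproxClosed X] {κ : Measure X} [IsFiniteMeasure κ] {m : Measure T}
    [SigmaFinite m] [m.IsOpenPosMeasure] {φ : T → X → X} (hφ : Continuous φ.uncurry)
    (h : MeasurePreserving (fun p : X × T => (φ p.2 p.1, p.2)) (κ.prod m) (κ.prod m)) (t : T) :
    κ.map (φ t) = κ := by
  refine (map_eq_iff_forall_lintegral_eq (hφ.uncurry_left t).measurable).2 fun f => ?_
  have hf : Measurable fun p : X × T => (f p.1 : ℝ≥0∞) :=
    f.measurable_coe_ennreal_comp.comp measurable_fst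
  have hcont := continuous_lintegral_comp κ hφ f
  suffices (fun t => ∫⁻ x, f (φ t x) ∂κ) =ᵐ[m] fun _ => ∫⁻ x, f x ∂κ from
    congrFun ((Continuous.ae_eq_iff_eq m hcont continuous_const).1 this) t
  refine ae_eq_of_forall_setLIntegral_eq_of_sigmaFinite hcont.measurable measurable_const
    fun s hs _ => ?_
  have h' := h.restrict_preimage (measurable_snd hs)
  have hprod : (κ.prod m).restrict (Prod.snd ⁻¹' s) = κ.prod (m.restrict s) := by
    rw [← Set.univ_prod, ← Measure.prod_restrict, Measure.restrict_univ]
  rw [Set.preimage_preimage, hprod] at h'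
  calc ∫⁻ t in s, ∫⁻ x, f (φ t x) ∂κ ∂m
      = ∫⁻ p : X × T, f (φ p.2 p.1) ∂κ.prod (m.restrict s) :=
        (lintegral_prod_symm _ (hf.comp h'.measurable).aemeasurable).symm
    _ = ∫⁻ p : X × T, f p.1 ∂κ.prod (m.restrict s) := h'.lintegral_comp hf
    _ = ∫⁻ _ in s, ∫⁻ x, f x ∂κ ∂m := lintegral_prod_symm _ hf.aemeasurable

end InvarianceOfMeasures

section ProductMeasures

variable {X Y : Type*} [MeasurableSpace X] [MeasurableSpace Y]

/-- The slice of a measure on `X × Y` over `A ⊆ X`, as a measure on `Y`: it takes the value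
`ρ (A ×ˢ B)` on `B`. If all slices are proportional to the same measure, then `ρ` is a product. -/
def slice (ρ : Measure (X × Y)) (A : Set X) : Measure Y :=
  (ρ.restrict (Prod.fst ⁻¹' A)).map Prod.snd

theorem slice_apply (ρ : Measure (X × Y)) (A : Set X) {B : Set Y} (hB : MeasurableSet B) :
    slice ρ A B = ρ (A ×ˢ B) := by
  rw [slice, Measure.map_apply measurable_snd hB, Measure.restrict_apply (measurable_snd hB),
    Set.inter_comm, Set.prod_eq]

theorem slice_le_map_snd (ρ : Measure (X × Y)) (A : Set X) : slice ρ A ≤ ρ.map Prod.snd :=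
  Measure.map_mono Measure.restrict_le_self measurable_snd

theorem measurePreserving_slice {ρ : Measure (X × Y)} {f : Y → Y} (hf : Measurable f)
    (h : ρ.map (Prod.map id f) = ρ) {A : Set X} (hA : MeasurableSet A) :
    MeasurePreserving f (slice ρ A) (slice ρ A) := by
  refine ⟨hf, Measure.ext fun B hB => ?_⟩
  rw [Measure.map_apply hf hB, slice_apply ρ A hB, slice_apply ρ A (hf hB)]
  nth_rw 2 [← h]
  rw [Measure.map_apply (measurable_id.prodMap hf) (hA.prod hB)]
  rfl

theorem exists_measure_ne_zero_ne_top (m : Measure Y) [SigmaFinite m] [NeZero m] :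
    ∃ B, MeasurableSet B ∧ m B ≠ 0 ∧ m B ≠ ∞ := by
  obtain ⟨B, hB, -, hpos, hfin⟩ := Measure.exists_subset_measure_lt_top (μ := m)
    MeasurableSet.univ (pos_iff_ne_zero.2 (Measure.measure_univ_ne_zero.2 (NeZero.ne m)))
  exact ⟨B, hB, hpos.ne', hfin.ne⟩

theorem exists_eq_prod_of_slice {ρ : Measure (X × Y)} {m : Measure Y} [SigmaFinite m] [NeZero m]
    (h : ∀ A, MeasurableSet A → ∃ c : ℝ≥0, slice ρ A = c • m) :
    ∃ κ : Measure X, IsFiniteMeasure κ ∧ ρ = κ.prod m := by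
  obtain ⟨B, hB, hB0, hB'⟩ := exists_measure_ne_zero_ne_top m
  set κ : Measure X := (m B)⁻¹ • (ρ.restrict (Prod.snd ⁻¹' B)).map Prod.fst
  have slice_eq {A : Set X} (hA : MeasurableSet A) : ∃ c : ℝ≥0, κ A = c ∧ slice ρ A = c • m := by
    obtain ⟨c, hc⟩ := h A hA
    have hκ : κ A = (m B)⁻¹ * slice ρ A B := by
      simp only [κ, slice_apply ρ A hB, Measure.smul_apply, Measure.map_apply measurable_fst hA,
        Measure.restrict_apply (measurable_fst hA), Set.prod_eq, smul_eq_mul]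
    refine ⟨c, ?_, hc⟩
    rw [hκ, hc, Measure.smul_apply, ENNReal.smul_def, smul_eq_mul, mul_comm, mul_assoc,
      ENNReal.mul_inv_cancel hB0 hB', mul_one]
  obtain ⟨c, hc, -⟩ := slice_eq MeasurableSet.univ
  have hfin : IsFiniteMeasure κ := ⟨hc ▸ ENNReal.coe_lt_top⟩
  refine ⟨κ, hfin, (Measure.prod_eq fun A C hA hC => ?_).symm⟩
  obtain ⟨c, hc, hslice⟩ := slice_eq hA
  rw [← slice_apply ρ A hC, hslice, Measure.smul_apply, hc, ENNReal.smul_def, smul_eq_mul]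

theorem eq_of_prod_eq_prod {μ μ' : Measure X} {m : Measure Y} [SigmaFinite m] [NeZero m]
    (h : μ.prod m = μ'.prod m) : μ = μ' := by
  obtain ⟨B, -, hB0, hB'⟩ := exists_measure_ne_zero_ne_top m
  ext A -
  have := congrArg (· (A ×ˢ B)) h
  simpa only [Measure.prod_prod, ENNReal.mul_left_inj hB0 hB'] using this

theorem exists_eq_prod_haar {H : Type*} [Group H] [TopologicalSpace H] [IsTopologicalGroup H]
    [LocallyCompactSpace H] [SecondCountableTopology H] [MeasurableSpace H] [BorelSpace H]
    (m : Measure H) [m.IsHaarMeasure] {ρ : Measure (X × H)}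
    [IsFiniteMeasureOnCompacts (ρ.map Prod.snd)]
    (h : ∀ g : H, ρ.map (Prod.map id (g * ·)) = ρ) :
    ∃ κ : Measure X, IsFiniteMeasure κ ∧ ρ = κ.prod m := by
  refine exists_eq_prod_of_slice fun A hA => ?_
  have : IsFiniteMeasureOnCompacts (slice ρ A) :=
    ⟨fun K hK => (slice_le_map_snd ρ A K).trans_lt hK.measure_lt_top⟩
  have : (slice ρ A).IsMulLeftInvariant :=
    ⟨fun g => (measurePreserving_slice (measurable_const_mul g) (h g) hA).map_eq⟩
  exact ⟨_, Measure.isMulLeftInvariant_eq_smul _ m⟩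

end ProductMeasures

/-! ### Pullback of measures along local homeomorphisms -/

section Pullback

section Fibers

variable {X Y : Type*} [MeasurableSpace X] {p : X → Y}

/-- The counting measure of the fibre of `p` over `y`, as a sum of Dirac masses: this way no
measurability of the fibre is needed. -/
def fiberCount (p : X → Y) (y : Y) : Measure X :=
  Measure.sum fun x : p ⁻¹' {y} => Measure.dirac (x : X)

theorem fiberCount_apply_of_injOn {A : Set X} (hA : MeasurableSet A) (hinj : Set.InjOn p A)
    (y : Y) : fiberCount p y A = (p '' A).indicator 1 y := by
  have hsum : fiberCount p y A = ∑' x : p ⁻¹' {y}, A.indicator 1 (x : X) := by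
    simp only [fiberCount, Measure.sum_apply _ hA, Measure.dirac_apply' _ hA]
  rw [hsum]
  by_cases hy : y ∈ p '' A
  · obtain ⟨x, hx, rfl⟩ := hy
    rw [tsum_eq_single ⟨x, rfl⟩, Set.indicator_of_mem hx,
      Set.indicator_of_mem (Set.mem_image_of_mem p hx), Pi.one_apply, Pi.one_apply]
    rintro ⟨x', hx'⟩ hne
    exact Set.indicator_of_notMem (fun hA' => hne (Subtype.ext (hinj hA' hx hx'))) _
  · rw [Set.indicator_of_notMem hy, ENNReal.tsum_eq_zero]
    exact fun ⟨x, hx⟩ => Set.indicator_of_notMem (fun hA' => hy ⟨x, hA', hx⟩) _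

end Fibers

variable {X Y : Type*} [TopologicalSpace X] [SecondCountableTopology X] [MeasurableSpace X]
  [BorelSpace X] [TopologicalSpace Y] [MeasurableSpace Y] [BorelSpace Y] {p : X → Y}

theorem exists_measurable_partition_injOn (hp : IsLocalHomeomorph p) :
    ∃ D : ℕ → Set X, (∀ n, MeasurableSet (D n)) ∧ Pairwise (Function.onFun Disjoint D) ∧
      ⋃ n, D n = Set.univ ∧ ∀ n, Set.InjOn p (D n) ∧
        ∀ A ⊆ D n, MeasurableSet A → MeasurableSet (p '' A) := by
  rcases isEmpty_or_nonempty X with _ | _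
  · exact ⟨fun _ => ∅, fun _ => .empty, fun _ _ _ => disjoint_bot_left,
      Subsingleton.elim _ _, fun _ => ⟨Set.injOn_empty p, fun A hA _ => by
        simp [Set.subset_empty_iff.1 hA]⟩⟩
  choose U hU hemb using isLocalHomeomorph_iff_isOpenEmbedding_restrict.1 hp
  have hV (x : X) : interior (U x) ∈ 𝓝 x := interior_mem_nhds.2 (hU x)
  obtain ⟨s, hs, hcover⟩ := TopologicalSpace.countable_cover_nhds hV
  have hs' : s.Nonempty := Set.nonempty_iff_ne_empty.2 fun h => by
    simp [h, Set.empty_ne_univ] at hcover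
  obtain ⟨e, rfl⟩ := hs.exists_eq_range hs'
  have hsub (n : ℕ) : disjointed (fun n => interior (U (e n))) n ⊆ U (e n) :=
    (disjointed_subset _ n).trans interior_subset
  refine ⟨disjointed fun n => interior (U (e n)),
    MeasurableSet.disjointed fun n => isOpen_interior.measurableSet, disjoint_disjointed _, ?_,
    fun n => ⟨(Set.injOn_iff_injective.2 (hemb (e n)).injective).mono (hsub n),
      fun A hA hmeas => ?_⟩⟩
  · rw [iUnion_disjointed, ← hcover, Set.biUnion_range]
  · rw [← Set.inter_eq_self_of_subset_right (hA.trans (hsub n)), ← Subtype.image_preimage_coe,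
      Set.image_image]
    exact (hemb (e n)).measurableEmbedding.measurableSet_image.2 (measurable_subtype_coe hmeas)

theorem measurableSet_image_of_isLocalHomeomorph (hp : IsLocalHomeomorph p) {A : Set X}
    (hA : MeasurableSet A) : MeasurableSet (p '' A) := by
  obtain ⟨D, hD, -, hcover, hinj⟩ := exists_measurable_partition_injOn hp
  rw [← Set.inter_univ A, ← hcover, Set.inter_iUnion, Set.image_iUnion]
  exact .iUnion fun n => (hinj n).2 _ Set.inter_subset_right (hA.inter (hD n))

theorem measure_ext_of_injOn (hp : IsLocalHomeomorph p) {ρ ρ' : Measure X}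
    (h : ∀ A, MeasurableSet A → Set.InjOn p A → ρ A = ρ' A) : ρ = ρ' := by
  obtain ⟨D, hD, -, hcover, hinj⟩ := exists_measurable_partition_injOn hp
  refine (Measure.ext_iff_of_iUnion_eq_univ hcover).2 fun n => Measure.ext fun A hA => ?_
  rw [Measure.restrict_apply hA, Measure.restrict_apply hA]
  exact h _ (hA.inter (hD n)) ((hinj n).1.mono Set.inter_subset_right)

theorem measurable_fiberCount (hp : IsLocalHomeomorph p) : Measurable (fiberCount p) := by
  obtain ⟨D, hD, hdisj, hcover, hinj⟩ := exists_measurable_partition_injOn hp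
  refine Measure.measurable_of_measurable_coe _ fun A hA => ?_
  have hsum (y : Y) : fiberCount p y A = ∑' n, (p '' (A ∩ D n)).indicator 1 y := by
    nth_rw 1 [← Set.inter_univ A, ← hcover, Set.inter_iUnion, measure_iUnion
      (fun i j hij => (hdisj hij).mono Set.inter_subset_right Set.inter_subset_right)
      fun n => hA.inter (hD n)]
    exact tsum_congr fun n => fiberCount_apply_of_injOn (hA.inter (hD n))
      ((hinj n).1.mono Set.inter_subset_right) y
  simp only [hsum]
  exact .tsum fun n => measurable_one.indicator
    (measurableSet_image_of_isLocalHomeomorph hp (hA.inter (hD n)))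

/-- The pullback of a measure along a local homeomorphism `p`: the measure that gives mass
`θ (p '' A)` to every Borel set `A` on which `p` is injective. -/
def pullback (p : X → Y) (θ : Measure Y) : Measure X := θ.bind (fiberCount p)

theorem pullback_apply_of_injOn (hp : IsLocalHomeomorph p) (θ : Measure Y) {A : Set X}
    (hA : MeasurableSet A) (hinj : Set.InjOn p A) :
    pullback p θ A = θ (p '' A) := by
  simp only [pullback, Measure.bind_apply hA (measurable_fiberCount hp).aemeasurable,
    fiberCount_apply_of_injOn hA hinj]
  exact lintegral_indicator_one (measurableSet_image_of_isLocalHomeomorph hp hA)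

theorem map_restrict_pullback (hp : IsLocalHomeomorph p) (θ : Measure Y) {U : Set X}
    (hU : MeasurableSet U) (hinj : Set.InjOn p U) :
    ((pullback p θ).restrict U).map p = θ.restrict (p '' U) := by
  have hmeas : Measurable p := hp.continuous.measurable
  ext B hB
  rw [Measure.map_apply hmeas hB, Measure.restrict_apply (hmeas hB), Measure.restrict_apply hB,
    pullback_apply_of_injOn hp θ ((hmeas hB).inter hU) (hinj.mono Set.inter_subset_right),
    Set.image_preimage_inter]

theorem measurePreserving_pullback (hp : IsLocalHomeomorph p) (θ : Measure Y) {f : X ≃ X}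
    (hf : Measurable f) {φ : Y ≃ Y} (hφ : MeasurePreserving φ θ θ)
    (hcomm : ∀ x, p (f x) = φ (p x)) :
    MeasurePreserving f (pullback p θ) (pullback p θ) := by
  refine ⟨hf, measure_ext_of_injOn hp fun A hA hinj => ?_⟩
  have hinj' : Set.InjOn p (f ⁻¹' A) := fun x hx x' hx' h =>
    f.injective (hinj hx hx' (by rw [hcomm, hcomm, h]))
  have himage : p '' (f ⁻¹' A) = φ ⁻¹' (p '' A) := by
    rw [← f.image_symm_eq_preimage, ← φ.image_symm_eq_preimage, Set.image_image,
      Set.image_image]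
    exact Set.image_congr fun x _ => by rw [φ.eq_symm_apply, ← hcomm, f.apply_symm_apply]
  rw [Measure.map_apply hf hA, pullback_apply_of_injOn hp θ (hf hA) hinj',
    pullback_apply_of_injOn hp θ hA hinj, himage,
    hφ.measure_preimage (measurableSet_image_of_isLocalHomeomorph hp hA).nullMeasurableSet]

end Pullback

/-! ### The uniform structure of tilings -/

namespace AffGroup

theorem smul_im (g : AffGroup) (z : ℍ) : (g • z).im = g.a * z.im := by
  simp [smul_def]

theorem smul_re (g : AffGroup) (z : ℍ) : (g • z).re = g.a * z.re + g.b := by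
  simp [smul_def, add_comm]

theorem dist_smul_smul (g : AffGroup) (z z' : ℍ) : dist (g • z) (g • z') = dist z z' :=
  g.isometry_smul.dist_eq z z'

theorem dist_inv_smul_I (g : AffGroup) :
    dist (g⁻¹ • I) I = dist (g • I) I := by
  rw [← dist_smul_smul g, smul_inv_smul, dist_comm]

theorem smul_I_injective : Function.Injective fun g : AffGroup => g • I := by
  intro g h hgh
  have him := congrArg UpperHalfPlane.im hgh
  have hre := congrArg UpperHalfPlane.re hgh
  simp only [smul_im, smul_re, UpperHalfPlane.I_im, UpperHalfPlane.I_re, mul_one, mul_zero,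
    zero_add] at him hre
  exact AffGroup.ext (Subtype.ext him) hre

theorem eq_one_of_forall_dist_lt {g : AffGroup}
    (h : ∀ ε > 0, dist (g • I) I < ε) : g = 1 := by
  refine smul_I_injective ?_
  simp only [one_smul]
  exact dist_le_zero.1 (le_of_forall_pos_le_add fun ε hε => by simpa using (h ε hε).le)

end AffGroup

namespace TileSet

theorem tileImage_mem_smul_tiles {g : AffGroup} {T : TileSet} {K : NonemptyCompacts ℍ} :
    tileImage g K ∈ (g • T).tiles ↔ K ∈ T.tiles := by
  have hinj : Function.Injective (tileImage g) :=
    Function.LeftInverse.injective (g := tileImage g⁻¹) fun L => by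
      rw [← tileImage_mul, inv_mul_cancel, tileImage_one]
  exact hinj.mem_set_image

theorem mem_smul_tiles {g : AffGroup} {T : TileSet} {K : NonemptyCompacts ℍ} :
    K ∈ (g • T).tiles ↔ tileImage g⁻¹ K ∈ T.tiles := by
  rw [← tileImage_mem_smul_tiles (g := g) (K := tileImage g⁻¹ K), ← tileImage_mul,
    mul_inv_cancel, tileImage_one]

/-- The tile `K` meets the open ball of radius `ρ` around `i`. -/
def Meets (K : NonemptyCompacts ℍ) (ρ : ℝ) : Prop :=
  ((K : Set ℍ) ∩ Metric.ball I ρ).Nonempty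

theorem Meets.mono {K : NonemptyCompacts ℍ} {ρ ρ' : ℝ} (h : Meets K ρ) (hρ : ρ ≤ ρ') :
    Meets K ρ' :=
  Set.Nonempty.mono (Set.inter_subset_inter_right _ (Metric.ball_subset_ball hρ)) h

theorem Meets.tileImage {K : NonemptyCompacts ℍ} {ρ ε : ℝ} (h : Meets K ρ) {g : AffGroup}
    (hg : dist (g • I) I < ε) : Meets (tileImage g K) (ρ + ε) := by
  obtain ⟨z, hz, hzρ⟩ := h
  refine ⟨g • z, ⟨z, hz, rfl⟩, (dist_triangle _ (g • I) _).trans_lt ?_⟩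
  rw [AffGroup.dist_smul_smul]
  exact add_lt_add hzρ hg

theorem exists_meets (K : NonemptyCompacts ℍ) : ∃ ρ > 0, Meets K ρ := by
  obtain ⟨z, hz⟩ := K.nonempty
  exact ⟨dist z I + 1, by positivity, z, hz, by simp⟩

theorem patch_eq_patch_iff {T T' : TileSet} {ρ : ℝ} :
    T.patch ρ = T'.patch ρ ↔ ∀ K, Meets K ρ → (K ∈ T.tiles ↔ K ∈ T'.tiles) := by
  simp only [Set.ext_iff, patch, Set.mem_ofPred_eq, Meets, and_congr_left_iff]

/-- Up to an element of `G` at distance less than `ε` from the identity, `T` and `T'` have the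
same patch in the ball of radius `1 / ε`. These relations are the entourages of a uniform structure
that induces the tiling topology. -/
def Near (ε : ℝ) (T T' : TileSet) : Prop :=
  ∃ g : AffGroup, dist (g • I) I < ε ∧
    ∀ K, Meets K (1 / ε) → (K ∈ (g • T).tiles ↔ K ∈ T'.tiles)

theorem Near.mono {ε ε' : ℝ} (hε : 0 < ε) (h : ε ≤ ε') {T T' : TileSet} (hT : Near ε T T') :
    Near ε' T T' := by
  obtain ⟨g, hg, hK⟩ := hT
  exact ⟨g, hg.trans_le h, fun K hm => hK K (hm.mono (one_div_le_one_div_of_le hε h))⟩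

theorem Near.refl {ε : ℝ} (hε : 0 < ε) (T : TileSet) : Near ε T T :=
  ⟨1, by simpa using hε, fun K _ => by rw [one_smul]⟩

theorem one_div_add_half_le {ε : ℝ} (hε : ε ∈ Set.Ioc 0 (1 / √2)) :
    1 / ε + ε / 2 ≤ 1 / (ε / 2) := by
  have hε1 : ε ≤ 1 :=
    hε.2.trans (div_le_one_of_le₀ (Real.one_le_sqrt.2 one_le_two) (Real.sqrt_nonneg 2))
  have h1 : 1 ≤ 1 / ε := by rwa [le_div_iff₀ hε.1, one_mul]
  have h2 : 1 / (ε / 2) = 2 * (1 / ε) := by field_simp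
  linarith

theorem Near.symm {ε : ℝ} (hε : ε ∈ Set.Ioc 0 (1 / √2)) {T T' : TileSet}
    (h : Near (ε / 2) T T') : Near ε T' T := by
  obtain ⟨g, hg, hK⟩ := h
  refine ⟨g⁻¹, by rw [AffGroup.dist_inv_smul_I]; linarith [hε.1], fun K hm => ?_⟩
  rw [mem_smul_tiles, inv_inv, ← hK _ ((hm.tileImage hg).mono (one_div_add_half_le hε)),
    tileImage_mem_smul_tiles]

theorem Near.trans {ε : ℝ} (hε : ε ∈ Set.Ioc 0 (1 / √2)) {T T' T'' : TileSet}
    (h : Near (ε / 2) T T') (h' : Near (ε / 2) T' T'') : Near ε T T'' := by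
  obtain ⟨g, hg, hK⟩ := h
  obtain ⟨g', hg', hK'⟩ := h'
  have hr := one_div_add_half_le hε
  refine ⟨g' * g, ?_, fun K hm => ?_⟩
  · rw [mul_smul]
    refine (dist_triangle _ (g' • I) _).trans_lt ?_
    rw [AffGroup.dist_smul_smul]
    linarith
  · rw [← AffGroup.dist_inv_smul_I] at hg'
    rw [← hK' K (hm.mono (by linarith [hε.1])), mul_smul, mem_smul_tiles,
      mem_smul_tiles (T := T')]
    exact hK _ ((hm.tileImage hg').mono hr)

theorem near_of_δ_lt {ε : ℝ} (hε : ε ≤ 1 / √2) {T T' : TileSet} (h : δ T T' < ε) :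
    Near ε T T' := by
  obtain h | ⟨η, ⟨hη, -, g, hg, hp⟩, hlt⟩ := δ_lt_iff.1 h
  · exact absurd h hε.not_gt
  · exact Near.mono hη hlt.le ⟨g, hg, patch_eq_patch_iff.1 hp⟩

theorem δ_lt_of_near {ε ε' : ℝ} (hε : ε ∈ Set.Ioc 0 (1 / √2)) (hlt : ε < ε') {T T' : TileSet}
    (h : Near ε T T') : δ T T' < ε' := by
  obtain ⟨g, hg, hK⟩ := h
  exact δ_lt_iff.2 (.inr ⟨ε, ⟨hε.1, hε.2, g, hg, patch_eq_patch_iff.2 hK⟩, hlt⟩)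

theorem half_mem_Ioc {ε : ℝ} (hε : ε ∈ Set.Ioc 0 (1 / √2)) : ε / 2 ∈ Set.Ioc 0 (1 / √2) :=
  ⟨half_pos hε.1, (half_le_self hε.1.le).trans hε.2⟩

theorem min_mem_Ioc {ε : ℝ} (hε : 0 < ε) : min ε (1 / √2) ∈ Set.Ioc 0 (1 / √2) :=
  ⟨lt_min hε (by positivity), min_le_right _ _⟩

/-- The filter basis of the sets `{(T, T') | Near ε T T'}` for `0 < ε ≤ 1 / √2`. -/
def nearBasis : FilterBasis (TileSet × TileSet) where
  sets := (fun ε => {p | Near ε p.1 p.2}) '' Set.Ioc 0 (1 / √2)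
  nonempty := (Set.nonempty_Ioc.2 (by positivity)).image _
  inter_sets := by
    rintro _ _ ⟨ε, hε, rfl⟩ ⟨ε', hε', rfl⟩
    have hmin : 0 < min ε ε' := lt_min hε.1 hε'.1
    exact ⟨_, ⟨min ε ε', ⟨hmin, (min_le_left _ _).trans hε.2⟩, rfl⟩, fun p hp =>
      ⟨hp.mono hmin (min_le_left _ _), hp.mono hmin (min_le_right _ _)⟩⟩

/-- The uniform structure of tilings that agree on large balls up to small motions. -/
abbrev nearUniformity : UniformSpace TileSet :=
  .ofCore <| .mkOfBasis nearBasis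
    (by rintro _ ⟨ε, hε, rfl⟩ T; exact .refl hε.1 T)
    (by
      rintro _ ⟨ε, hε, rfl⟩
      exact ⟨_, ⟨ε / 2, half_mem_Ioc hε, rfl⟩, fun p hp => hp.symm hε⟩)
    (by
      rintro _ ⟨ε, hε, rfl⟩
      refine ⟨_, ⟨ε / 2, half_mem_Ioc hε, rfl⟩, ?_⟩
      rintro ⟨T, T''⟩ ⟨T', h, h'⟩
      exact h.trans hε h')

theorem nearUniformity_hasBasis :
    (@uniformity _ nearUniformity).HasBasis (· ∈ Set.Ioc 0 (1 / √2))
      fun ε => {p | Near ε p.1 p.2} :=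
  nearBasis.hasBasis.to_hasBasis (by rintro _ ⟨ε, hε, rfl⟩; exact ⟨ε, hε, subset_rfl⟩)
    fun ε hε => ⟨_, ⟨ε, hε, rfl⟩, subset_rfl⟩

theorem topology_eq_nearUniformity :
    (inferInstance : TopologicalSpace TileSet) = nearUniformity.toTopologicalSpace := by
  ext U
  rw [isOpen_def, @isOpen_uniformity _ nearUniformity]
  refine forall₂_congr fun T hT => ?_
  rw [nearUniformity_hasBasis.mem_iff]
  constructor
  · rintro ⟨ε, hε, hU⟩
    refine ⟨min (ε / 2) (1 / √2), min_mem_Ioc (half_pos hε), ?_⟩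
    rintro ⟨_, T'⟩ h rfl
    exact hU T' (δ_lt_of_near (min_mem_Ioc (half_pos hε))
      ((min_le_left _ _).trans_lt (half_lt_self hε)) h)
  · rintro ⟨ε, hε, hU⟩
    exact ⟨ε, hε.1, fun T' hT' => hU (a := (T, T')) (near_of_δ_lt hε.2 hT') rfl⟩

instance : UniformSpace TileSet := nearUniformity.replaceTopology topology_eq_nearUniformity

theorem nhds_basis_near (T : TileSet) :
    (𝓝 T).HasBasis (· ∈ Set.Ioc 0 (1 / √2)) fun ε => {T' | Near ε T T'} :=
  nhds_basis_uniformity' (show (uniformity TileSet).HasBasis _ _ from nearUniformity_hasBasis)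

theorem near_of_inseparable {T T' : TileSet} (h : Inseparable T T') {ε : ℝ} (hε : 0 < ε) :
    Near ε T T' := by
  have hmem : {T'' | Near (min ε (1 / √2)) T T''} ∈ 𝓝 T' :=
    h.nhds_eq ▸ (nhds_basis_near T).mem_of_mem (min_mem_Ioc hε)
  exact Near.mono (min_mem_Ioc hε).1 (min_le_left _ _) (Set.mem_ofPred.1 (mem_of_mem_nhds hmem))

/-- A collection of tiles is rigid if no two distinct small motions of the same tile belong to it.
Rigidity is what separates collections that agree on all balls up to arbitrarily small motions. -/
def IsRigid (T : TileSet) : Prop :=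
  ∀ K, ∃ ε > 0, ∀ g h : AffGroup, dist (g • I) I < ε →
    dist (h • I) I < ε → tileImage g K ∈ T.tiles →
    tileImage h K ∈ T.tiles → g = h

theorem IsRigid.mono {T T' : TileSet} (hT' : T'.IsRigid) (h : T.tiles ⊆ T'.tiles) :
    T.IsRigid := fun K => by
  obtain ⟨ε, hε, hrigid⟩ := hT' K
  exact ⟨ε, hε, fun g g' hg hg' hK hK' => hrigid g g' hg hg' (h hK) (h hK')⟩

theorem exists_tileImage_mem_of_inseparable {T T' : TileSet} (h : Inseparable T T')
    {K : NonemptyCompacts ℍ} (hK : K ∈ T.tiles) {ε : ℝ} (hε : 0 < ε) :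
    ∃ g : AffGroup, dist (g • I) I < ε ∧
      tileImage g K ∈ T'.tiles := by
  obtain ⟨ρ, hρ, hmeets⟩ := exists_meets K
  have hη : 0 < min ε (1 / (ρ + ε)) := lt_min hε (by positivity)
  obtain ⟨g, hg, hagree⟩ := near_of_inseparable h hη
  have hgε := hg.trans_le (min_le_left _ _)
  refine ⟨g, hgε, (hagree _ ((hmeets.tileImage hgε).mono ?_)).1 (tileImage_mem_smul_tiles.2 hK)⟩
  rw [le_one_div (by positivity) hη]
  exact min_le_right _ _

theorem IsRigid.tiles_subset_of_inseparable {T T' : TileSet} (hT' : T'.IsRigid)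
    (h : Inseparable T T') : T.tiles ⊆ T'.tiles := by
  intro K hK
  obtain ⟨ε, hε, hrigid⟩ := hT' K
  obtain ⟨g, hg, hgK⟩ := exists_tileImage_mem_of_inseparable h hK hε
  suffices g = 1 by rwa [this, tileImage_one] at hgK
  refine AffGroup.eq_one_of_forall_dist_lt fun η hη => ?_
  obtain ⟨g', hg', hgK'⟩ := exists_tileImage_mem_of_inseparable h hK (lt_min hη hε)
  rw [hrigid g g' hg (hg'.trans_le (min_le_right _ _)) hgK hgK']
  exact hg'.trans_le (min_le_left _ _)

theorem IsRigid.eq_of_inseparable {T T' : TileSet} (hT' : T'.IsRigid) (h : Inseparable T T') :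
    T = T' := by
  have hsub := hT'.tiles_subset_of_inseparable h
  exact TileSet.ext (hsub.antisymm ((hT'.mono hsub).tiles_subset_of_inseparable h.symm))

end TileSet

/-! ### The dyadic solenoid -/

/-- The dyadic solenoid, as the group of sequences `y` of points of the circle with
`y k = 2 y (k + 1)`: the inverse limit of the doubling map, indexed by the levels of the rows of
tiles. -/
def solenoid : AddSubgroup (ℤ → UnitAddCircle) where
  carrier := {y | ∀ k, y k = (2 : ℕ) • y (k + 1)}
  zero_mem' k := by simp
  add_mem' {x y} hx hy k := by
    rw [Pi.add_apply, hx k, hy k, Pi.add_apply, smul_add]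
  neg_mem' {x} hx k := by
    rw [Pi.neg_apply, hx k, Pi.neg_apply, smul_neg]

namespace solenoid

theorem apply_eq_two_pow_nsmul (y : solenoid) (k : ℤ) (n : ℕ) :
    y.1 k = (2 ^ n : ℕ) • y.1 (k + n) := by
  induction n with
  | zero => simp
  | succ n ih =>
    rw [ih, y.2 (k + n), smul_smul, pow_succ]
    push_cast
    rw [add_assoc]

theorem apply_eq_of_le {x y : solenoid} {j k : ℤ} (hjk : j ≤ k) (h : x.1 k = y.1 k) :
    x.1 j = y.1 j := by
  obtain ⟨n, rfl⟩ := Int.le.dest hjk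
  rw [apply_eq_two_pow_nsmul x j n, apply_eq_two_pow_nsmul y j n, h]

theorem continuous_coe_apply (k : ℤ) : Continuous fun y : solenoid => y.1 k :=
  (continuous_apply k).comp continuous_subtype_val

theorem isClosed : IsClosed (solenoid : Set (ℤ → UnitAddCircle)) := by
  change IsClosed {y : ℤ → UnitAddCircle | ∀ k, y k = (2 : ℕ) • y (k + 1)}
  rw [Set.ofPred_forall]
  exact isClosed_iInter fun k => isClosed_eq (continuous_apply k) (by fun_prop)

instance : SecondCountableTopology solenoid :=
  TopologicalSpace.Subtype.secondCountableTopology _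

instance : CompactSpace solenoid := isCompact_iff_compactSpace.1 isClosed.isCompact

/-- The dense one-parameter subgroup `s ↦ (s / 2 ^ k)ₖ` of the solenoid, along which `ℝ` acts on
the tilings that the solenoid encodes. -/
def line : ℝ →+ solenoid where
  toFun s := ⟨fun k => ((s / 2 ^ k : ℝ) : UnitAddCircle), fun k => by
    rw [← AddCircle.coe_nsmul, nsmul_eq_mul, zpow_add_one₀ two_ne_zero]
    push_cast
    field_simp⟩
  map_zero' := Subtype.ext (funext fun k => by simp)
  map_add' s t := Subtype.ext (funext fun k => by
    change (((s + t) / 2 ^ k : ℝ) : UnitAddCircle) = (s / 2 ^ k : ℝ) + (t / 2 ^ k : ℝ)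
    rw [add_div, AddCircle.coe_add])

theorem line_add_apply (s : ℝ) (y : solenoid) (k : ℤ) :
    (line s + y).1 k = ((s / 2 ^ k : ℝ) : UnitAddCircle) + y.1 k := rfl

theorem continuous_line : Continuous line :=
  Continuous.subtype_mk (continuous_pi fun _ =>
    (AddCircle.continuous_mk' (1 : ℝ)).comp (continuous_id.div_const _)) _

theorem isOpenMap_line_apply (k : ℤ) : IsOpenMap fun s : ℝ => (line s).1 k := by
  have hscale : IsOpenMap fun s : ℝ => s / 2 ^ k := by
    simp only [div_eq_mul_inv]
    exact (Homeomorph.mulRight₀ ((2 ^ k : ℝ)⁻¹) (by positivity)).isOpenMap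
  exact QuotientAddGroup.isOpenMap_coe.comp hscale

theorem exists_line_apply_eq (k : ℤ) (c : UnitAddCircle) : ∃ s, (line s).1 k = c := by
  obtain ⟨u, rfl⟩ := QuotientAddGroup.mk_surjective c
  refine ⟨u * 2 ^ k, ?_⟩
  change ((u * 2 ^ k / 2 ^ k : ℝ) : UnitAddCircle) = u
  rw [mul_div_cancel_right₀ _ (by positivity)]

theorem denseRange_line : DenseRange line := by
  intro y
  choose s hs using fun n : ℕ => exists_line_apply_eq n (y.1 n)
  refine mem_closure_of_tendsto (f := fun n => line (s n)) (b := Filter.atTop) ?_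
    (Filter.Eventually.of_forall fun n => ⟨s n, rfl⟩)
  rw [tendsto_subtype_rng, tendsto_pi_nhds]
  intro k
  refine tendsto_const_nhds.congr' ?_
  filter_upwards [Filter.eventually_ge_atTop k.toNat] with n hn
  exact apply_eq_of_le (by omega) (hs n).symm

end solenoid

/-! ### Coding of the hull by the solenoid -/

namespace AffGroup

theorem R_zpow (k : ℤ) : R ^ k = ⟨⟨2, two_pos⟩ ^ k, 0⟩ := by
  let dilation : PosReal →* AffGroup :=
    { toFun := fun a => ⟨a, 0⟩
      map_one' := rfl
      map_mul' := fun a b => AffGroup.ext rfl (by simp [mul_b]) }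
  exact (map_zpow dilation ⟨2, two_pos⟩ k).symm

theorem S_zpow (n : ℤ) : S ^ n = translation n := by
  let translationHom : Multiplicative ℝ →* AffGroup :=
    { toFun := fun s => translation s.toAdd
      map_one' := rfl
      map_mul' := fun s t => translation_add _ _ }
  have hS : S = translationHom (Multiplicative.ofAdd 1) := rfl
  rw [hS, ← map_zpow, ← ofAdd_zsmul, zsmul_one]
  rfl

/-- The element of `G` that carries a prototile to the tile at abscissa `u` in the row of level `k`,
abscissae in that row being measured in units of `2 ^ k`. -/
def frame (k : ℤ) (u : ℝ) : AffGroup := R ^ k * translation u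

theorem frame_a (k : ℤ) (u : ℝ) : ((frame k u).a : ℝ) = 2 ^ k := by
  simp [frame, R_zpow, translation, mul_a]

theorem frame_b (k : ℤ) (u : ℝ) : (frame k u).b = 2 ^ k * u := by
  simp [frame, R_zpow, translation, mul_b]

theorem frame_inj {j k : ℤ} {u v : ℝ} : frame j u = frame k v ↔ j = k ∧ u = v := by
  refine ⟨fun h => ?_, by rintro ⟨rfl, rfl⟩; rfl⟩
  have ha := congrArg (fun g => (g.a : ℝ)) h
  have hb := congrArg AffGroup.b h
  simp only [frame_a, frame_b] at ha hb
  obtain rfl := zpow_right_injective₀ two_pos (by norm_num) ha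
  exact ⟨rfl, mul_left_cancel₀ (by positivity) hb⟩

theorem translation_mul_frame (s : ℝ) (k : ℤ) (u : ℝ) :
    translation s * frame k u = frame k (s / 2 ^ k + u) := by
  refine AffGroup.ext (Subtype.ext ?_) ?_
  · rw [frame_a, mul_a, Positive.val_mul, frame_a]
    simp [translation]
  · rw [frame_b, mul_b, frame_b]
    simp only [translation, Positive.val_one]
    field_simp
    ring

theorem a_le_one_of_tileImage_eq {g : AffGroup} {K : NonemptyCompacts ℍ}
    (h : tileImage g K = K) : (g.a : ℝ) ≤ 1 := by
  obtain ⟨z, hz, hmax⟩ :=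
    K.isCompact.exists_isMaxOn K.nonempty UpperHalfPlane.continuous_im.continuousOn
  have hgz : g • z ∈ (tileImage g K : Set ℍ) := ⟨z, hz, rfl⟩
  have him : (g • z).im ≤ z.im := hmax (h ▸ hgz)
  rw [smul_im] at him
  exact (mul_le_iff_le_one_left z.im_pos).1 him

theorem b_nonpos_of_tileImage_eq {g : AffGroup} {K : NonemptyCompacts ℍ}
    (h : tileImage g K = K) (ha : g.a = 1) : g.b ≤ 0 := by
  obtain ⟨z, hz, hmax⟩ :=
    K.isCompact.exists_isMaxOn K.nonempty UpperHalfPlane.continuous_re.continuousOn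
  have hgz : g • z ∈ (tileImage g K : Set ℍ) := ⟨z, hz, rfl⟩
  have hre : (g • z).re ≤ z.re := hmax (h ▸ hgz)
  rw [smul_re, ha, Positive.val_one, one_mul] at hre
  linarith

theorem eq_one_of_tileImage_eq {g : AffGroup} {K : NonemptyCompacts ℍ}
    (h : tileImage g K = K) : g = 1 := by
  have hinv : tileImage g⁻¹ K = K := by
    conv_lhs => rw [← h]
    rw [← tileImage_mul, inv_mul_cancel, tileImage_one]
  have ha : g.a = 1 := by
    refine le_antisymm (a_le_one_of_tileImage_eq h) ?_
    exact inv_le_one'.1 (a_le_one_of_tileImage_eq hinv)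
  have hinv_b : g⁻¹.b = -g.b := by
    change -((g.a⁻¹ : PosReal) : ℝ) * g.b = -g.b
    rw [ha, inv_one, Positive.val_one, neg_one_mul]
  have hb := b_nonpos_of_tileImage_eq hinv (by rw [inv_a, ha, inv_one])
  rw [hinv_b] at hb
  exact AffGroup.ext ha (le_antisymm (b_nonpos_of_tileImage_eq h ha) (neg_nonpos.1 hb))

theorem tileImage_left_injective (K : NonemptyCompacts ℍ) :
    Function.Injective fun g : AffGroup => tileImage g K := by
  intro g h hgh
  refine (inv_mul_eq_one.1 (eq_one_of_tileImage_eq (K := K) ?_)).symm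
  rw [tileImage_mul, show tileImage g K = tileImage h K from hgh, ← tileImage_mul,
    inv_mul_cancel, tileImage_one]

theorem level_eq_of_dist_lt {j k : ℤ} {u v : ℝ}
    (h : dist (frame j u • I) (frame k v • I) < Real.log 2) : j = k := by
  have hlog := (UpperHalfPlane.dist_log_im_le _ _).trans_lt h
  simp only [smul_im, frame_a, UpperHalfPlane.I_im, mul_one, Real.log_zpow, Real.dist_eq,
    ← sub_mul, abs_mul, abs_of_pos (Real.log_pos one_lt_two)] at hlog
  have habs := lt_of_mul_lt_mul_right (hlog.trans_eq (one_mul _).symm) (Real.log_nonneg one_le_two)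
  exact sub_eq_zero.1 (Int.abs_lt_one_iff.1 (by exact_mod_cast habs))

theorem abs_sub_lt_one_of_dist_lt {k : ℤ} {u v : ℝ}
    (h : dist (frame k u • I) (frame k v • I) < Real.log 2) : |u - v| < 1 := by
  have hcosh := Real.cosh_lt_cosh.2
    (show |dist (frame k u • I) (frame k v • I)| < |Real.log 2| by
      rwa [abs_of_nonneg dist_nonneg, abs_of_pos (Real.log_pos one_lt_two)])
  rw [UpperHalfPlane.cosh_dist', Real.cosh_log two_pos] at hcosh
  simp only [smul_im, smul_re, frame_a, frame_b, UpperHalfPlane.I_im, UpperHalfPlane.I_re] at hcosh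
  have hk : (0 : ℝ) < 2 ^ k := by positivity
  rw [div_lt_iff₀ (by positivity)] at hcosh
  rw [← sq_lt_one_iff_abs_lt_one]
  nlinarith

theorem frame_eq_frame_of_dist_lt {j k : ℤ} {u v : ℝ} {y : solenoid}
    (hu : (u : UnitAddCircle) = y.1 j) (hv : (v : UnitAddCircle) = y.1 k)
    (h : dist (frame j u • I) (frame k v • I) < Real.log 2) : frame j u = frame k v := by
  obtain rfl := level_eq_of_dist_lt h
  obtain ⟨n, hn⟩ := (AddCircle.coe_eq_zero_iff (1 : ℝ)).1
    (show ((u - v : ℝ) : UnitAddCircle) = 0 by rw [AddCircle.coe_sub, hu, hv, sub_self])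
  rw [zsmul_one] at hn
  have hn0 : n = 0 := by
    have hn1 := abs_sub_lt_one_of_dist_lt h
    rw [← hn] at hn1
    exact Int.abs_lt_one_iff.1 (by exact_mod_cast hn1)
  rw [hn0, Int.cast_zero] at hn
  rw [sub_eq_zero.1 hn.symm]

theorem continuous_translation_smul_I : Continuous fun s : ℝ => translation s • I := by
  rw [UpperHalfPlane.isEmbedding_coe.continuous_iff]
  have hcoe : UpperHalfPlane.coe ∘ (fun s : ℝ => translation s • I) =
      fun s : ℝ => (s : ℂ) + Complex.I := by
    funext s
    simp [smul_def, translation]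
  rw [hcoe]
  fun_prop

end AffGroup

/-- The tiling by copies of `P` encoded by a point `y` of the solenoid: the abscissae of the tiles
in the row of level `k` are the representatives of `y k`. -/
def solenoidTiling (P : NonemptyCompacts ℍ) (y : solenoid) : TileSet :=
  ⟨{K | ∃ (k : ℤ) (u : ℝ), (u : UnitAddCircle) = y.1 k ∧ tileImage (AffGroup.frame k u) P = K}⟩

section solenoidTiling

open AffGroup

variable (P : NonemptyCompacts ℍ)

theorem tileImage_frame_mem_solenoidTiling {P : NonemptyCompacts ℍ} {y : solenoid} {k : ℤ}
    {u : ℝ} :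
    tileImage (frame k u) P ∈ (solenoidTiling P y).tiles ↔ (u : UnitAddCircle) = y.1 k := by
  refine ⟨?_, fun hu => ⟨k, u, hu, rfl⟩⟩
  rintro ⟨j, v, hv, h⟩
  obtain ⟨rfl, rfl⟩ := frame_inj.1 (tileImage_left_injective P h)
  exact hv

theorem solenoidTiling_injective : Function.Injective (solenoidTiling P) := by
  intro x y hxy
  refine Subtype.ext (funext fun k => ?_)
  obtain ⟨u, hu⟩ := QuotientAddGroup.mk_surjective (x.1 k)
  rw [← hu]
  exact tileImage_frame_mem_solenoidTiling.1
    (hxy ▸ tileImage_frame_mem_solenoidTiling (P := P).2 hu)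

theorem translation_smul_solenoidTiling (s : ℝ) (y : solenoid) :
    translation s • solenoidTiling P y = solenoidTiling P (solenoid.line s + y) := by
  refine TileSet.ext (Set.ext fun K => ⟨?_, ?_⟩)
  · rintro ⟨_, ⟨k, u, hu, rfl⟩, rfl⟩
    rw [← tileImage_mul, translation_mul_frame, tileImage_frame_mem_solenoidTiling,
      solenoid.line_add_apply, AddCircle.coe_add, hu]
  · rintro ⟨k, u, hu, rfl⟩
    refine ⟨_, ⟨k, u - s / 2 ^ k, ?_, rfl⟩, ?_⟩
    · rw [AddCircle.coe_sub, hu, solenoid.line_add_apply, add_sub_cancel_left]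
    · rw [← tileImage_mul, translation_mul_frame, add_sub_cancel]

theorem penrose_eq_solenoidTiling : penrose = solenoidTiling prototile 0 := by
  refine TileSet.ext (Set.ext fun K => ⟨?_, ?_⟩)
  · rintro ⟨k, n, rfl⟩
    rw [S_zpow]
    exact ⟨k, n, (AddCircle.coe_eq_zero_iff 1).2 ⟨n, zsmul_one n⟩, rfl⟩
  · rintro ⟨k, u, hu, rfl⟩
    obtain ⟨n, rfl⟩ := (AddCircle.coe_eq_zero_iff 1).1 hu
    exact ⟨k, n, by rw [S_zpow, zsmul_one, frame]⟩

theorem isRigid_solenoidTiling (y : solenoid) : (solenoidTiling P y).IsRigid := by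
  intro K
  by_cases hK : ∃ q, tileImage q P = K
  · obtain ⟨q, rfl⟩ := hK
    have hlog : 0 < Real.log 2 := Real.log_pos one_lt_two
    obtain ⟨ε, hε, hmove⟩ := TileSet.exists_dist_smul_lt (q • I) (half_pos hlog)
    refine ⟨ε, hε, fun g h hg hh hgK hhK => ?_⟩
    rw [← tileImage_mul] at hgK hhK
    obtain ⟨j, u, hu, hgq⟩ := hgK
    obtain ⟨k, v, hv, hhq⟩ := hhK
    replace hgq := tileImage_left_injective P hgq
    replace hhq := tileImage_left_injective P hhq
    have hdist : dist (frame j u • I) (frame k v • I) < Real.log 2 := by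
      rw [hgq, hhq, mul_smul, mul_smul]
      linarith [dist_triangle_right (g • q • I) (h • q • I) (q • I), hmove g hg, hmove h hh]
    exact mul_right_cancel (hgq.symm.trans ((frame_eq_frame_of_dist_lt hu hv hdist).trans hhq))
  · refine ⟨1, one_pos, fun g h _ _ hgK _ => (hK ?_).elim⟩
    obtain ⟨k, u, -, hgK⟩ := hgK
    exact ⟨g⁻¹ * frame k u, by rw [tileImage_mul, hgK, ← tileImage_mul, inv_mul_cancel,
      tileImage_one]⟩

theorem exists_forall_level_le_of_meets (ρ : ℝ) :
    ∃ N : ℤ, ∀ k u, TileSet.Meets (tileImage (frame k u) P) ρ → k ≤ N := by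
  obtain ⟨z₀, -, hmin⟩ :=
    P.isCompact.exists_isMinOn P.nonempty UpperHalfPlane.continuous_im.continuousOn
  obtain ⟨N, hN⟩ := pow_unbounded_of_one_lt (Real.exp ρ / z₀.im) one_lt_two
  refine ⟨N, ?_⟩
  rintro k u ⟨_, ⟨z, hz, rfl⟩, hzρ⟩
  have hlog := (UpperHalfPlane.dist_log_im_le (frame k u • z) I).trans_lt hzρ
  rw [UpperHalfPlane.I_im, Real.log_one, Real.dist_eq, sub_zero] at hlog
  have him : 2 ^ k * z.im < Real.exp ρ := by
    rw [← frame_a k u, ← smul_im, ← Real.log_lt_iff_lt_exp (UpperHalfPlane.im_pos _)]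
    exact (le_abs_self _).trans_lt hlog
  have hlevel : (2 : ℝ) ^ k < 2 ^ (N : ℤ) := by
    rw [zpow_natCast]
    refine lt_of_le_of_lt ((le_div_iff₀ z₀.im_pos).2 ?_) hN
    exact (mul_le_mul_of_nonneg_left (hmin hz) (by positivity)).trans him.le
  exact ((zpow_lt_zpow_iff_right₀ one_lt_two).1 hlevel).le

theorem mem_solenoidTiling_congr {P K : NonemptyCompacts ℍ} {ρ : ℝ} {N : ℤ}
    (hN : ∀ k u, TileSet.Meets (tileImage (frame k u) P) ρ → k ≤ N) {x y : solenoid}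
    (hxy : x.1 N = y.1 N) (hK : TileSet.Meets K ρ) :
    K ∈ (solenoidTiling P x).tiles ↔ K ∈ (solenoidTiling P y).tiles := by
  refine exists₂_congr fun k u => and_congr_left ?_
  rintro rfl
  rw [solenoid.apply_eq_of_le (hN k u hK) hxy]

/-- High rows do not meet a given ball, and a small motion along `solenoid.line` corrects the one
coordinate that governs all the lower rows. -/
theorem continuous_solenoidTiling : Continuous (solenoidTiling P) := by
  refine continuous_iff_continuousAt.2 fun y => ?_
  rw [ContinuousAt, (TileSet.nhds_basis_near _).tendsto_right_iff]
  intro ε hε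
  obtain ⟨N, hN⟩ := exists_forall_level_le_of_meets P (1 / ε)
  have hsmall : {s : ℝ | dist (translation s • I) I < ε} ∈ 𝓝 0 := by
    refine (isOpen_lt (continuous_translation_smul_I.dist continuous_const)
      continuous_const).mem_nhds ?_
    simpa [translation_zero] using hε.1
  have hcircle := (solenoid.isOpenMap_line_apply N).image_mem_nhds hsmall
  have hdiff : Filter.Tendsto (fun y' : solenoid => y'.1 N - y.1 N) (𝓝 y)
      (𝓝 ((solenoid.line 0).1 N)) := by
    have hcont : Continuous fun y' : solenoid => y'.1 N - y.1 N :=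
      (solenoid.continuous_coe_apply N).sub continuous_const
    simpa using hcont.tendsto y
  filter_upwards [hdiff hcircle] with y' hy'
  obtain ⟨s, hs, hsN⟩ := hy'
  refine ⟨translation s, hs, fun K hK => ?_⟩
  rw [translation_smul_solenoidTiling]
  exact mem_solenoidTiling_congr hN (eq_sub_iff_add_eq.1 hsN) hK

end solenoidTiling

theorem orbitN_eq_image_range_line :
    orbitN = solenoidTiling prototile '' Set.range solenoid.line := by
  rw [← Set.range_comp]
  refine congrArg Set.range (funext fun s => ?_)
  rw [penrose_eq_solenoidTiling, translation_smul_solenoidTiling, add_zero, Function.comp_apply]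

theorem closure_orbitN : closure orbitN = Set.range (solenoidTiling prototile) := by
  rw [orbitN_eq_image_range_line]
  refine Set.Subset.antisymm (fun T hT => ?_)
    ((continuous_solenoidTiling _).range_subset_closure_image_dense solenoid.denseRange_line)
  have hT' := closure_mono (Set.image_subset_range _ _) hT
  rw [(isCompact_range (continuous_solenoidTiling _)).closure_eq_biUnion_inseparable] at hT'
  obtain ⟨_, ⟨y, rfl⟩, hy⟩ := Set.mem_iUnion₂.1 hT'
  exact ⟨y, ((isRigid_solenoidTiling _ y).eq_of_inseparable (Inseparable.symm hy)).symm⟩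

namespace HullN

instance : T2Space HullN := by
  have : R1Space HullN := inferInstanceAs (R1Space ↥(closure orbitN))
  have : T0Space HullN := by
    refine ⟨fun T T' h => Subtype.ext ?_⟩
    obtain ⟨y, hy⟩ : T'.1 ∈ Set.range (solenoidTiling prototile) := closure_orbitN ▸ T'.2
    have hrigid : T'.1.IsRigid := hy ▸ isRigid_solenoidTiling prototile y
    exact hrigid.eq_of_inseparable (h.map continuous_subtype_val)
  infer_instance

/-- The encoding of the hull by the solenoid, as a bijection. -/
def equivSolenoid : solenoid ≃ HullN :=
  (Equiv.ofInjective _ (solenoidTiling_injective prototile)).trans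
    (Equiv.setCongr closure_orbitN.symm)

/-- The encoding of the hull by the solenoid. It carries the flow along `solenoid.line` to the
translation flow. -/
def homeoSolenoid : solenoid ≃ₜ HullN :=
  Continuous.homeoOfEquivCompactToT2 (f := equivSolenoid)
    ((continuous_solenoidTiling prototile).subtype_mk _)

theorem vadd_homeoSolenoid (s : ℝ) (y : solenoid) :
    s +ᵥ homeoSolenoid y = homeoSolenoid (solenoid.line s + y) :=
  Subtype.ext (translation_smul_solenoidTiling prototile s y)

instance : CompactSpace HullN := homeoSolenoid.compactSpace

instance : SecondCountableTopology HullN := homeoSolenoid.symm.secondCountableTopology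

instance : ContinuousVAdd ℝ HullN := by
  refine ⟨?_⟩
  have hconj : (fun p : ℝ × HullN => p.1 +ᵥ p.2) = fun p : ℝ × HullN =>
      homeoSolenoid (solenoid.line p.1 + homeoSolenoid.symm p.2) := by
    funext p
    rw [← vadd_homeoSolenoid, Homeomorph.apply_symm_apply]
  rw [hconj]
  have := solenoid.continuous_line
  fun_prop

theorem continuous_R : Continuous R :=
  ((TileSet.continuous_smul _).comp continuous_subtype_val).subtype_mk _

theorem continuous_R_symm : Continuous R.symm :=
  ((TileSet.continuous_smul _).comp continuous_subtype_val).subtype_mk _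

end HullN

/-! ### Unique ergodicity of the hull -/

/-- The Haar probability measure of the solenoid. -/
abbrev solenoid.haar : Measure solenoid := Measure.addHaarMeasure ⊤

instance : IsProbabilityMeasure solenoid.haar := ⟨Measure.addHaarMeasure_self⟩

theorem exists_eq_smul_solenoid_haar (κ : Measure solenoid) [IsFiniteMeasure κ]
    (h : ∀ s, κ.map (solenoid.line s + ·) = κ) : ∃ c : ℝ≥0, κ = c • solenoid.haar := by
  have : κ.IsAddLeftInvariant := isAddLeftInvariant_of_dense κ solenoid.denseRange_line <| by
    rintro _ ⟨s, rfl⟩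
    exact h s
  exact ⟨_, Measure.isAddLeftInvariant_eq_smul κ _⟩

/-- The translation-invariant probability measure `ν` on the hull: the image of the Haar measure of
the solenoid. -/
def hullMeasure : Measure HullN := solenoid.haar.map HullN.homeoSolenoid

instance : IsProbabilityMeasure hullMeasure :=
  Measure.isProbabilityMeasure_map HullN.homeoSolenoid.continuous.aemeasurable

theorem map_vadd_map_homeoSolenoid (s : ℝ) (κ : Measure solenoid) :
    (κ.map HullN.homeoSolenoid).map (s +ᵥ ·) =
      (κ.map (solenoid.line s + ·)).map HullN.homeoSolenoid := by
  have hvadd : Measurable (s +ᵥ · : HullN → HullN) := (continuous_const_vadd s).measurable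
  have hhomeo : Measurable HullN.homeoSolenoid := HullN.homeoSolenoid.continuous.measurable
  rw [Measure.map_map hvadd hhomeo, Measure.map_map hhomeo (measurable_const_add _)]
  exact congrArg (Measure.map · κ) (funext fun y => HullN.vadd_homeoSolenoid s y)

theorem map_vadd_hullMeasure (s : ℝ) : hullMeasure.map (s +ᵥ ·) = hullMeasure := by
  rw [hullMeasure, map_vadd_map_homeoSolenoid, map_add_left_eq_self]

theorem exists_eq_smul_hullMeasure (κ : Measure HullN) [IsFiniteMeasure κ]
    (h : ∀ s : ℝ, κ.map (s +ᵥ ·) = κ) : ∃ c : ℝ≥0, κ = c • hullMeasure := by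
  let e := HullN.homeoSolenoid.toMeasurableEquiv
  have hκ : (κ.map e.symm).map e = κ := e.map_map_symm
  obtain ⟨c, hc⟩ := exists_eq_smul_solenoid_haar (κ.map e.symm) fun s => by
    refine e.map_measurableEquiv_injective ?_
    have hs := map_vadd_map_homeoSolenoid s (κ.map e.symm)
    exact hs.symm.trans ((congrArg (Measure.map (s +ᵥ ·)) hκ).trans ((h s).trans hκ.symm))
  refine ⟨c, ?_⟩
  rw [← hκ, hc, Measure.map_smul]
  rfl

theorem isUniqueInvariantProbability_hullMeasure : IsUniqueInvariantProbability hullMeasure := by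
  refine ⟨inferInstance, ⟨fun s A hA => ?_⟩, fun κ hκ hinv => ?_⟩
  · rw [← Measure.map_apply (continuous_const_vadd s).measurable hA, map_vadd_hullMeasure]
  · obtain ⟨c, rfl⟩ := exists_eq_smul_hullMeasure κ fun s =>
      (measurePreserving_vadd s κ).map_eq
    have huniv := hκ.measure_univ
    rw [Measure.smul_apply, measure_univ] at huniv
    have hc : c = 1 := by simpa [ENNReal.smul_def] using huniv
    rw [hc, one_smul]

theorem exists_eq_hullMeasure_prod {Z : Type*} [MeasurableSpace Z] (κ : Measure (HullN × Z))
    [IsFiniteMeasure κ] (h : ∀ s : ℝ, κ.map (Prod.map (s +ᵥ ·) id) = κ) :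
    ∃ μ : Measure Z, IsFiniteMeasure μ ∧ κ = hullMeasure.prod μ := by
  have hvadd (s : ℝ) : Measurable (s +ᵥ · : HullN → HullN) := (continuous_const_vadd s).measurable
  have hswap (s : ℝ) : (κ.map Prod.swap).map (Prod.map id (s +ᵥ ·)) = κ.map Prod.swap := by
    nth_rw 2 [← h s]
    rw [Measure.map_map (measurable_id.prodMap (hvadd s)) measurable_swap,
      Measure.map_map measurable_swap ((hvadd s).prodMap measurable_id)]
    rfl
  obtain ⟨μ, hμ, hprod⟩ := exists_eq_prod_of_slice (m := hullMeasure) fun A hA => by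
    have : IsFiniteMeasure (slice (κ.map Prod.swap) A) := by
      unfold slice
      infer_instance
    exact exists_eq_smul_hullMeasure _ fun s =>
      (measurePreserving_slice (hvadd s) (hswap s) hA).map_eq
  refine ⟨μ, hμ, ?_⟩
  rw [← Measure.prod_swap, ← hprod, Measure.map_map measurable_swap measurable_swap,
    Prod.swap_swap_eq, Measure.map_id]

/-! ### Invariant measures on the double suspension -/

instance : IsTopologicalGroup PosReal where
  continuous_mul :=
    ((continuous_subtype_val.comp continuous_fst).mul
      (continuous_subtype_val.comp continuous_snd)).subtype_mk _
  continuous_inv := (continuous_subtype_val.inv₀ fun t : PosReal => t.2.ne').subtype_mk _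

instance : LocallyCompactSpace PosReal := (isOpen_Ioi (a := (0 : ℝ))).locallyCompactSpace

namespace DoubleSuspension

variable {r : ℕ} (w : ℤ → Fin r)

theorem continuous_subshiftMap : Continuous (subshiftMap w) :=
  ((shift r).continuous.comp continuous_subtype_val).subtype_mk _

theorem continuous_subshiftMap_symm : Continuous (subshiftMap w).symm :=
  ((shift r).symm.continuous.comp continuous_subtype_val).subtype_mk _

theorem continuous_suspMap : Continuous (suspMap w) :=
  HullN.continuous_R.prodMap ((continuous_subshiftMap w).prodMap (continuous_id.div_const _))

theorem continuous_suspMap_symm : Continuous (suspMap w).symm :=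
  HullN.continuous_R_symm.prodMap
    ((continuous_subshiftMap_symm w).prodMap (continuous_id.mul continuous_const))

theorem continuous_suspMap_zpow (n : ℤ) : Continuous ⇑(suspMap w ^ n) := by
  induction n with
  | zero => exact continuous_id
  | succ n ih =>
    rw [zpow_add_one, Equiv.Perm.coe_mul]
    exact ih.comp (continuous_suspMap w)
  | pred n ih =>
    rw [zpow_sub_one, Equiv.Perm.coe_mul]
    exact ih.comp (continuous_suspMap_symm w)

theorem suspMap_zpow_height (n : ℤ) (x : TotalSpace w) :
    (((suspMap w ^ n) x).2.2 : ℝ) = x.2.2 / 2 ^ n := by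
  have suspMap_height (x : TotalSpace w) : ((suspMap w x).2.2 : ℝ) = x.2.2 / 2 := by
    change ((x.2.2 / ⟨2, two_pos⟩ : PosReal) : ℝ) = x.2.2 / 2
    simp [div_eq_mul_inv]
  induction n generalizing x with
  | zero => simp
  | succ n ih =>
    rw [zpow_add_one, Equiv.Perm.mul_apply, ih, suspMap_height, zpow_add_one₀ two_ne_zero,
      div_div, mul_comm]
  | pred n ih =>
    have h := suspMap_height ((suspMap w)⁻¹ x)
    rw [← Equiv.Perm.mul_apply, mul_inv_cancel, Equiv.Perm.one_apply] at h
    rw [zpow_sub_one, Equiv.Perm.mul_apply, ih, zpow_sub_one₀ two_ne_zero, h]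
    field_simp

theorem proj_eq_iff {x y : TotalSpace w} :
    proj w x = proj w y ↔ ∃ n : ℤ, (suspMap w ^ n) x = y :=
  Quotient.eq (r := Equiv.Perm.SameCycle.setoid (suspMap w))

theorem proj_suspMap (x : TotalSpace w) : proj w (suspMap w x) = proj w x :=
  ((proj_eq_iff w).2 ⟨1, by rw [zpow_one]⟩).symm

theorem isQuotientMap_proj : IsQuotientMap (proj w) := isQuotientMap_quotient_mk'

theorem isOpenMap_proj : IsOpenMap (proj w) := by
  intro U hU
  have hpre : proj w ⁻¹' (proj w '' U) = ⋃ n : ℤ, ⇑(suspMap w ^ n) ⁻¹' U := by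
    ext x
    simp only [Set.mem_preimage, Set.mem_iUnion, Set.mem_image]
    constructor
    · rintro ⟨y, hy, hxy⟩
      obtain ⟨n, rfl⟩ := (proj_eq_iff w).1 hxy.symm
      exact ⟨n, hy⟩
    · rintro ⟨n, hn⟩
      exact ⟨_, hn, ((proj_eq_iff w).2 ⟨n, rfl⟩).symm⟩
  rw [← (isQuotientMap_proj w).isOpen_preimage, hpre]
  exact isOpen_iUnion fun n => hU.preimage (continuous_suspMap_zpow w n)

/-- The points of the total space whose height lies in `(c, 2c)`. As `suspMap` halves the heights,
no two of them are in the same orbit. -/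
def openSlab (c : ℝ) : Set (TotalSpace w) := {x | (x.2.2 : ℝ) ∈ Set.Ioo c (2 * c)}

theorem isOpen_openSlab (c : ℝ) : IsOpen (openSlab w c) :=
  isOpen_Ioo.preimage (by fun_prop)

theorem exists_coe_mem_Ioo_two_mul (t : PosReal) : ∃ c : ℝ, (t : ℝ) ∈ Set.Ioo c (2 * c) := by
  have : (0 : ℝ) < t := t.2
  exact ⟨2 / 3 * t, by linarith, by linarith⟩

theorem injOn_proj_openSlab (c : ℝ) : Set.InjOn (proj w) (openSlab w c) := by
  rintro x ⟨hx1, hx2⟩ y ⟨hy1, hy2⟩ hxy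
  obtain ⟨n, rfl⟩ := (proj_eq_iff w).1 hxy
  have hpow : (0 : ℝ) < 2 ^ n := by positivity
  rw [suspMap_zpow_height, lt_div_iff₀ hpow] at hy1
  rw [suspMap_zpow_height, div_lt_iff₀ hpow] at hy2
  have hc : 0 < c := by linarith
  have hlt : (2 : ℝ) ^ n < 2 ^ (1 : ℤ) := by
    rw [zpow_one]
    exact lt_of_mul_lt_mul_left (by linarith) hc.le
  have hgt : (2 : ℝ) ^ (-1 : ℤ) < 2 ^ n := by
    rw [zpow_neg_one]
    exact lt_of_mul_lt_mul_left (by linarith) (mul_pos two_pos hc).le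
  rw [zpow_lt_zpow_iff_right₀ one_lt_two] at hlt hgt
  obtain rfl : n = 0 := by lia
  rfl

theorem isOpenEmbedding_proj_openSlab (c : ℝ) :
    IsOpenEmbedding ((openSlab w c).domRestrict (proj w)) :=
  .of_continuous_injective_isOpenMap
    ((isQuotientMap_proj w).continuous.comp continuous_subtype_val)
    (Set.injOn_iff_injective.1 (injOn_proj_openSlab w c))
    ((isOpenMap_proj w).comp (isOpen_openSlab w c).isOpenMap_subtype_val)

theorem isLocalHomeomorph_proj : IsLocalHomeomorph (proj w) :=
  isLocalHomeomorph_iff_isOpenEmbedding_restrict.2 fun x =>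
    let ⟨c, hc⟩ := exists_coe_mem_Ioo_two_mul x.2.2
    ⟨_, (isOpen_openSlab w c).mem_nhds hc, isOpenEmbedding_proj_openSlab w c⟩

theorem isLocallyImage_pullback (θ : Measure (DoubleSuspension w)) :
    IsLocallyImage w θ (pullback (proj w) θ) := fun x =>
  let ⟨c, hc⟩ := exists_coe_mem_Ioo_two_mul x.2.2
  ⟨_, isOpen_openSlab w c, hc, isOpenEmbedding_proj_openSlab w c,
    (map_restrict_pullback (isLocalHomeomorph_proj w) θ (isOpen_openSlab w c).measurableSet
      (injOn_proj_openSlab w c)).symm⟩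

theorem continuous_totalAct (g : AffGroup) : Continuous (totalAct w g) := by
  have hshift : Continuous fun x : TotalSpace w => g.b / ((g.a : ℝ) * x.2.2) :=
    continuous_const.div (by fun_prop) fun x => (mul_pos g.a.2 x.2.2.2).ne'
  unfold totalAct
  fun_prop

instance : ContinuousConstSMul AffGroup (DoubleSuspension w) :=
  ⟨fun g => (isQuotientMap_proj w).continuous_iff.2
    ((isQuotientMap_proj w).continuous.comp (continuous_totalAct w g))⟩

/-- The action of `g : AffGroup` on the total space, as a bijection. -/
def totalActEquiv (g : AffGroup) : Equiv.Perm (TotalSpace w) where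
  toFun := totalAct w g
  invFun := totalAct w g⁻¹
  left_inv x := by rw [← totalAct_mul, inv_mul_cancel, totalAct_one]
  right_inv x := by rw [← totalAct_mul, mul_inv_cancel, totalAct_one]

section InvarianceOfPullback

variable (θ : Measure (DoubleSuspension w))

theorem measurePreserving_suspMap_pullback :
    MeasurePreserving (suspMap w) (pullback (proj w) θ) (pullback (proj w) θ) :=
  measurePreserving_pullback (isLocalHomeomorph_proj w) θ (continuous_suspMap w).measurable
    (φ := Equiv.refl _) (.id θ) (proj_suspMap w)

theorem measurePreserving_totalAct_pullback [SMulInvariantMeasure AffGroup _ θ] (g : AffGroup) :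
    MeasurePreserving (totalAct w g) (pullback (proj w) θ) (pullback (proj w) θ) :=
  measurePreserving_pullback (isLocalHomeomorph_proj w) θ (f := totalActEquiv w g)
    (continuous_totalAct w g).measurable (φ := MulAction.toPerm g) (measurePreserving_smul g θ)
    fun _ => rfl

instance isLocallyFiniteMeasure_map_height_pullback [IsFiniteMeasure θ] :
    IsLocallyFiniteMeasure ((pullback (proj w) θ).map fun x => x.2.2) := by
  refine ⟨fun t => ?_⟩
  obtain ⟨c, hc⟩ := exists_coe_mem_Ioo_two_mul t
  have hV : IsOpen {s : PosReal | (s : ℝ) ∈ Set.Ioo c (2 * c)} :=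
    isOpen_Ioo.preimage continuous_subtype_val
  refine ⟨_, hV.mem_nhds hc, ?_⟩
  rw [Measure.map_apply (by fun_prop) hV.measurableSet]
  exact (pullback_apply_of_injOn (isLocalHomeomorph_proj w) θ
    (isOpen_openSlab w c).measurableSet (injOn_proj_openSlab w c)).trans_lt (measure_lt_top θ _)

end InvarianceOfPullback

section ProductDecomposition

/-- The action of `G` on the total space, with the height split off. -/
def splitAct (g : AffGroup) (p : (HullN × Subshift w) × PosReal) :
    (HullN × Subshift w) × PosReal :=
  (((g.b / (g.a * p.2)) +ᵥ p.1.1, p.1.2), g.a * p.2)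

variable {w} {ρ : Measure (TotalSpace w)}

theorem measurePreserving_splitAct {g : AffGroup} (h : MeasurePreserving (totalAct w g) ρ ρ) :
    MeasurePreserving (splitAct w g) (ρ.map MeasurableEquiv.prodAssoc.symm)
      (ρ.map MeasurableEquiv.prodAssoc.symm) := by
  have he := (MeasurableEquiv.prodAssoc (α := HullN) (β := Subshift w)
    (γ := PosReal)).symm.measurable.measurePreserving ρ
  exact (he.comp h).comp (he.symm _)

theorem exists_map_prodAssoc_symm_eq_prod (m : Measure PosReal) [m.IsHaarMeasure]
    [IsFiniteMeasureOnCompacts (ρ.map fun x => x.2.2)]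
    (h : ∀ g, MeasurePreserving (totalAct w g) ρ ρ) :
    ∃ κ : Measure (HullN × Subshift w), IsFiniteMeasure κ ∧
      ρ.map MeasurableEquiv.prodAssoc.symm = κ.prod m := by
  have : IsFiniteMeasureOnCompacts ((ρ.map MeasurableEquiv.prodAssoc.symm).map Prod.snd) := by
    rw [Measure.map_map measurable_snd (MeasurableEquiv.measurable _)]
    assumption
  refine exists_eq_prod_haar m fun a => ?_
  have hdil : splitAct w ⟨a, 0⟩ = Prod.map id (a * ·) := by
    funext p
    simp [splitAct, Prod.map]
  exact hdil ▸ (measurePreserving_splitAct (h ⟨a, 0⟩)).map_eq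

theorem map_vadd_eq_of_map_prodAssoc_symm_eq_prod {m : Measure PosReal} [m.IsHaarMeasure]
    {κ : Measure (HullN × Subshift w)} [IsFiniteMeasure κ]
    (hρ : ρ.map MeasurableEquiv.prodAssoc.symm = κ.prod m)
    (h : ∀ g, MeasurePreserving (totalAct w g) ρ ρ) (s : ℝ) :
    κ.map (Prod.map (s +ᵥ ·) id) = κ := by
  have hpres := measurePreserving_splitAct (h ⟨1, s⟩)
  rw [hρ] at hpres
  have hflow : Continuous (Function.uncurry fun (t : PosReal) (p : HullN × Subshift w) =>
      Prod.map ((s / (t : ℝ)) +ᵥ ·) id p) := by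
    have : Continuous fun p : PosReal × HullN × Subshift w => s / (p.1 : ℝ) :=
      continuous_const.div (by fun_prop) fun p => p.1.2.ne'
    unfold Function.uncurry Prod.map
    fun_prop
  have hsplit : splitAct w ⟨1, s⟩ = fun p => (Prod.map ((s / (p.2 : ℝ)) +ᵥ ·) id p.1, p.2) := by
    funext p
    simp [splitAct, Prod.map]
  have hmap := forall_map_eq_of_measurePreserving_prod hflow (hsplit ▸ hpres) 1
  simpa only [Positive.val_one, div_one] using hmap

theorem exists_eq_hullMeasure_prod_prod (m : Measure PosReal) [m.IsHaarMeasure]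
    [IsFiniteMeasureOnCompacts (ρ.map fun x => x.2.2)]
    (h : ∀ g, MeasurePreserving (totalAct w g) ρ ρ) :
    ∃ μ : Measure (Subshift w), IsFiniteMeasure μ ∧ ρ = hullMeasure.prod (μ.prod m) := by
  obtain ⟨κ, hκ, hρ⟩ := exists_map_prodAssoc_symm_eq_prod m h
  obtain ⟨μ, hμ, rfl⟩ := exists_eq_hullMeasure_prod κ
    (map_vadd_eq_of_map_prodAssoc_symm_eq_prod hρ h)
  refine ⟨μ, hμ, ?_⟩
  rw [← Measure.prodAssoc_prod, ← hρ]
  exact MeasurableEquiv.prodAssoc.map_map_symm.symm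

theorem measurePreserving_subshiftMap_of_prod {m : Measure PosReal} [m.IsHaarMeasure]
    {μ : Measure (Subshift w)} [IsFiniteMeasure μ]
    (h : MeasurePreserving (suspMap w) (hullMeasure.prod (μ.prod m))
      (hullMeasure.prod (μ.prod m))) :
    MeasurePreserving (subshiftMap w) μ μ := by
  have hσ := (continuous_subshiftMap w).measurable
  have hdiv := measurePreserving_div_right m (⟨2, two_pos⟩ : PosReal)
  refine ⟨hσ, eq_of_prod_eq_prod (m := m) ?_⟩
  calc (μ.map (subshiftMap w)).prod m
      = (μ.prod m).map (Prod.map (subshiftMap w) (· / ⟨2, two_pos⟩)) := by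
        rw [← Measure.map_prod_map μ m hσ hdiv.measurable, hdiv.map_eq]
    _ = ((hullMeasure.prod (μ.prod m)).map Prod.snd).map
          (Prod.map (subshiftMap w) (· / ⟨2, two_pos⟩)) := by
        rw [Measure.map_snd_prod, measure_univ, one_smul]
    _ = ((hullMeasure.prod (μ.prod m)).map (suspMap w)).map Prod.snd := by
        rw [Measure.map_map (hσ.prodMap hdiv.measurable) measurable_snd,
          Measure.map_map measurable_snd h.measurable]
        rfl
    _ = μ.prod m := by
        rw [h.map_eq, Measure.map_snd_prod, measure_univ, one_smul]

end ProductDecomposition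

end DoubleSuspension

end

end HypPenrose

theorem mainTheorem8 (r : ℕ) (w : ℤ → Fin r)
    (m : MeasureTheory.Measure HypPenrose.PosReal) (hm : m.IsHaarMeasure) :
    ∃ ν : MeasureTheory.Measure HypPenrose.HullN,
      HypPenrose.IsUniqueInvariantProbability ν ∧
      ∀ θ : MeasureTheory.Measure (HypPenrose.DoubleSuspension w),
        MeasureTheory.IsFiniteMeasure θ →
        MeasureTheory.SMulInvariantMeasure HypPenrose.AffGroup
          (HypPenrose.DoubleSuspension w) θ →
        ∃ μ : MeasureTheory.Measure (HypPenrose.Subshift w),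
          MeasureTheory.IsFiniteMeasure μ ∧
          MeasureTheory.MeasurePreserving (HypPenrose.subshiftMap w) μ μ ∧
          HypPenrose.DoubleSuspension.IsLocallyImage w θ (ν.prod (μ.prod m)) := by
  refine ⟨HypPenrose.hullMeasure, HypPenrose.isUniqueInvariantProbability_hullMeasure,
    fun θ _ _ => ?_⟩
  obtain ⟨μ, hμ, hprod⟩ := HypPenrose.DoubleSuspension.exists_eq_hullMeasure_prod_prod m
    (HypPenrose.DoubleSuspension.measurePreserving_totalAct_pullback w θ)
  refine ⟨μ, hμ, ?_, ?_⟩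
  · apply HypPenrose.DoubleSuspension.measurePreserving_subshiftMap_of_prod (m := m)
    exact hprod ▸ HypPenrose.DoubleSuspension.measurePreserving_suspMap_pullback w θ
  · exact hprod ▸ HypPenrose.DoubleSuspension.isLocallyImage_pullback w θ
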